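/- **Setting.** An episodic MDP has a state space $\mathcal S$, an action space $\mathcal A$, episode length $H\ge 1$, initial distribution $P_0$, transition kernels $P_h(\cdot\mid s,a)$, and reward distributions $\mathcal R(\cdot\mid s,a)$ on $[0,1]$. ($\mathcal S,\mathcal A$ are measurable spaces, the diagonal of $\mathcal A\times\mathcal A$ is measurable, and $\pi(a\mid s)$ denotes the mass that $\pi(\cdot\mid s)$ gives to the action $a$.) Executing a stationary policy $\pi:\mathcal S\to\Delta(\mathcal A)$ gives a law $\mathbb P^\pi$ of trajectories $(s_h,a_h,r_h)_{h=1}^H$. Let $J(\pi)=\mathbb E^\pi[\sum_{h=1}^H r_h]$, let $V_h^\pi(s)$ and $Q_h^\pi(s,a)$ be the expected reward collected from step $h$ on when $s_h=s$, respectively $s_h=s$ and $a_h=a$, and $\pi$ is followed otherwise, and let $d^\pi=\frac1H\sum_{h=1}^H\mathbb P^\pi(s_h\in\cdot)$. Let $D_H^2(P,Q)=\int(\sqrt{dP/d\omega}-\sqrt{dQ/d\omega})^2\,d\omega$ for any dominating measure $\omega$. Let $\mathcal B$ be a finite set of $B$ stationary policies that contains a deterministic expert policy $\pi^{\mathrm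 E}$. For $u\in\Delta(\mathcal B)$ the each-step mixing policy is $\bar\pi_u(\cdot\mid s)=\sum_{\pi\in\mathcal B}u(\pi)\,\pi(\cdot\mid s)$. **Algorithm (Stagger with exponential weights), $N_{\mathrm{int}}\ge1$ rounds.** In round $n$, with losses $\ell^i(\pi)=\log\bigl(1/\pi(a^{*,i}\mid s^i)\bigr)\in[0,\infty]$ from the earlier rounds $i<n$, set $$u^n(\pi)=\frac{\exp\bigl(-\sum_{i<n}\ell^i(\pi)\bigr)}{\sum_{\pi'\in\mathcal B}\exp\bigl(-\sum_{i<n}\ell^i(\pi')\bigr)},\qquad \pi^n=\bar\pi_{u^n},$$ sample $s^n\sim d^{\pi^n}$ and query the expert for $a^{*,n}=\pi^{\mathrm E}(s^n)$. The output $\hat\pi$ is the first-step uniform mixture of $\pi^1,\dots,\pi^{N_{\mathrm{int}}}$: one $\pi^n$ is drawn uniformly at random at the start of the episode and executed throughout. **Theorem.** Let $\delta\in(0,1)$. With probability at least $1-\delta$ over the run of the algorithm, $$\sum_{n=1}^{N_{\mathrm{int}}}\mathbb E_{s\sim d^{\pi^n}}\Bigl[D_H^2\bigl(\pi^n(\cdot\mid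 s),\pi^{\mathrm E}(\cdot\mid s)\bigr)\Bigr]\le\log B+2\log(1/\delta),$$ and, on the same event, for every real $\mu$: 1. if the pair of the MDP and the expert is $\mu$-recoverable, i.e. $V_h^{\pi^{\mathrm E}}(s)-Q_h^{\pi^{\mathrm E}}(s,a)\le\mu$ for all $h\in[H]$, $s\in\mathcal S$, $a\in\mathcal A$, then $$J(\pi^{\mathrm E})-J(\hat\pi)\le\mu H\,\frac{\log B+2\log(1/\delta)}{N_{\mathrm{int}}};$$ 2. if $Q_h^{\pi^{\mathrm E}}(s,a)-V_h^{\pi^{\mathrm E}}(s)\le\mu$ for all $h\in[H]$, $s\in\mathcal S$, $a\in\mathcal A$, then $$J(\hat\pi)-J(\pi^{\mathrm E})\le\mu H\,\frac{\log B+2\log(1/\delta)}{N_{\mathrm{int}}}.$$ -/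

import Mathlib

open MeasureTheory ProbabilityTheory
open scoped ENNReal

noncomputable section

/-- An episodic Markov decision process with measurable state space `S` and action space `A`:
episode length, initial distribution, step-dependent transition kernels, and a reward distribution
on `[0,1]`.  Steps are numbered `0, …, horizon - 1`; `trans h` moves from step `h` to step `h + 1`,
so only `trans h` with `h + 1 < horizon` matters. -/
structure EpisodicMDP (S A : Type*) [MeasurableSpace S] [MeasurableSpace A] where
  horizon : ℕ
  init : Measure S
  init_prob : IsProbabilityMeasure init
  trans : ℕ → Kernel (S × A) S
  trans_markov : ∀ h, IsMarkovKernel (trans h)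
  reward : Kernel (S × A) unitInterval
  reward_markov : IsMarkovKernel reward

/-- Stationary policies `S → Δ(A)`. -/
abbrev Policy (S A : Type*) [MeasurableSpace S] [MeasurableSpace A] :=
  {π : Kernel S A // IsMarkovKernel π}

/-- One step `(s_h, a_h, r_h)` of a trajectory. -/
abbrev Step (S A : Type*) := S × A × unitInterval

/-- A policy is deterministic if it plays a point mass in every state. -/
def Policy.IsDeterministic {S A : Type*} [MeasurableSpace S] [MeasurableSpace A]
    (π : Policy S A) : Prop :=
  ∃ e : S → A, ∀ s, π.1 s = Measure.dirac (e s)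

/-- Squared Hellinger distance `∫ (√(dP/dω) - √(dQ/dω))² dω`, with the dominating measure
`ω = P + Q`. -/
def hellingerSq {X : Type*} [MeasurableSpace X] (P Q : Measure X) : ℝ :=
  ∫ x, (√(P.rnDeriv (P + Q) x).toReal - √(Q.rnDeriv (P + Q) x).toReal) ^ 2 ∂(P + Q)

/-- Total reward of a trajectory (or of a trajectory segment). -/
def totalReward {S A : Type*} {k : ℕ} (τ : Fin k → Step S A) : ℝ :=
  ∑ j, ((τ j).2.2 : ℝ)

namespace EpisodicMDP

variable {S A : Type*} [MeasurableSpace S] [MeasurableSpace A]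

/-- Given a kernel `κ` producing the `k` steps after step `h` from the state at step `h + 1`, this
is the law of the `k + 1` steps starting with state `s` and action `a` at step `h`: draw
`r ∼ R(s, a)` and `s' ∼ P_h(s, a)` independently, then the remaining steps from `κ s'`. -/
def prependStep (M : EpisodicMDP S A) (h : ℕ) {k : ℕ} (κ : Kernel S (Fin k → Step S A)) :
    Kernel (S × A) (Fin (k + 1) → Step S A) :=
  (Kernel.id ×ₖ (M.reward ×ₖ (κ ∘ₖ M.trans h))).map
    fun x : (S × A) × unitInterval × (Fin k → Step S A) =>
      (Fin.cons (x.1.1, x.1.2, x.2.1) x.2.2 : Fin (k + 1) → Step S A)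

/-- Law of the `k` steps `(s_j, a_j, r_j)`, `h ≤ j < h + k`, when `π` is executed from the given
state at step `h`. -/
def rollout (M : EpisodicMDP S A) (π : Kernel S A) :
    (k : ℕ) → (h : ℕ) → Kernel S (Fin k → Step S A)
  | 0, _ => Kernel.const S (Measure.dirac Fin.elim0)
  | k + 1, h => M.prependStep h (M.rollout π k (h + 1)) ∘ₖ (Kernel.id ×ₖ π)

/-- Law `ℙ^π` of the whole trajectory `(s_h, a_h, r_h)_h` under `π`. -/
def trajLaw (M : EpisodicMDP S A) (π : Kernel S A) : Measure (Fin M.horizon → Step S A) :=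
  M.init.bind (M.rollout π M.horizon 0)

/-- Expected return under a given law of trajectories. -/
def expectedReturn (M : EpisodicMDP S A) (law : Measure (Fin M.horizon → Step S A)) : ℝ :=
  ∫ τ, totalReward τ ∂law

/-- `J(π)`. -/
def J (M : EpisodicMDP S A) (π : Kernel S A) : ℝ := M.expectedReturn (M.trajLaw π)

/-- `V_h^π(s)`. -/
def V (M : EpisodicMDP S A) (π : Kernel S A) (h : Fin M.horizon) (s : S) : ℝ :=
  ∫ τ, totalReward τ ∂(M.rollout π (M.horizon - h) h s)

/-- `Q_h^π(s, a)`. -/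
def Q (M : EpisodicMDP S A) (π : Kernel S A) (h : Fin M.horizon) (s : S) (a : A) : ℝ :=
  ∫ τ, totalReward τ ∂(M.prependStep h (M.rollout π (M.horizon - h - 1) (h + 1)) (s, a))

/-- `μ`-recoverability: replacing the expert's action by an arbitrary one for a single step loses
at most `μ` in expected return. -/
def IsRecoverable (M : EpisodicMDP S A) (πE : Kernel S A) (μ : ℝ) : Prop :=
  ∀ (h : Fin M.horizon) (s : S) (a : A), M.V πE h s - M.Q πE h s a ≤ μ

/-- State visitation distribution `d^π = (1/H) ∑_h ℙ^π(s_h ∈ ·)`. -/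
def stateVisitation (M : EpisodicMDP S A) (π : Kernel S A) : Measure S :=
  (M.horizon : ℝ≥0∞)⁻¹ • ∑ h : Fin M.horizon, (M.trajLaw π).map fun τ => (τ h).1

/-- Trajectory law of the first-step uniform mixture of `π 0, …, π (N - 1)`: one of the policies is
drawn uniformly at the beginning of the episode and executed throughout. -/
def firstStepMixtureLaw (M : EpisodicMDP S A) {N : ℕ} (π : Fin N → Kernel S A) :
    Measure (Fin M.horizon → Step S A) :=
  (N : ℝ≥0∞)⁻¹ • ∑ n, M.trajLaw (π n)

end EpisodicMDP

section Stagger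

variable {S A : Type*} [MeasurableSpace S] [MeasurableSpace A]

/-- The each-step mixing policy `π̄_u(a | s) = ∑_{π ∈ 𝓑} u(π) π(a | s)`. -/
def eachStepMix (𝓑 : Finset (Policy S A)) (u : Policy S A → ℝ≥0∞) : Kernel S A where
  toFun s := ∑ π ∈ 𝓑, u π • π.1 s
  measurable' := by
    refine Measure.measurable_of_measurable_coe _ fun E hE => ?_
    simp only [Measure.coe_finsetSum, Finset.sum_apply, Measure.smul_apply, smul_eq_mul]
    exact Finset.measurable_sum _ fun π _ => (π.1.measurable_coe hE).const_mul _

/-- Log loss `log (1 / π(a | s)) ∈ [0, ∞]` of a policy on an annotated state `(s, a)`. -/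
def logLoss (π : Kernel S A) (x : S × A) : EReal := ENNReal.log (1 / π x.1 {x.2})

/-- Unnormalised exponential weight (learning rate `1`) of a base policy after the annotated states
`hist`; infinite cumulative loss gives weight `0`. -/
def expWeight {n : ℕ} (hist : Fin n → S × A) (π : Policy S A) : ℝ≥0∞ :=
  EReal.exp (-∑ i, logLoss π.1 (hist i))

/-- The point of `Δ(𝓑)` chosen by the exponential weight algorithm after the annotated states
`hist`. -/
def expWeightsDist (𝓑 : Finset (Policy S A)) {n : ℕ} (hist : Fin n → S × A) (π : Policy S A) :
    ℝ≥0∞ :=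
  expWeight hist π / ∑ π' ∈ 𝓑, expWeight hist π'

/-- The policy that the online learning oracle returns after the annotated states `hist`. -/
def learnerPolicy (𝓑 : Finset (Policy S A)) {n : ℕ} (hist : Fin n → S × A) : Kernel S A :=
  eachStepMix 𝓑 (expWeightsDist 𝓑 hist)

/-- Law of the annotated states `(s^n, a^{*,n})` of the first `n` rounds of Stagger.  In each round
the learner's current policy `π^n` is computed from the past, `s^n ∼ d^{π^n}` is sampled, and the
expert annotates it with `a^{*,n} ∼ πE(· | s^n)`. -/
def staggerLaw (M : EpisodicMDP S A) (𝓑 : Finset (Policy S A)) (πE : Policy S A) :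
    (n : ℕ) → Measure (Fin n → S × A)
  | 0 => Measure.dirac Fin.elim0
  | n + 1 => (staggerLaw M 𝓑 πE n).bind fun hist =>
      (M.stateVisitation (learnerPolicy 𝓑 hist) ⊗ₘ πE.1).map
        fun x => (Fin.snoc hist x : Fin (n + 1) → S × A)

/-- The policy `π^n` used in round `n` of a run with annotated states `run`; it depends only on the
earlier rounds. -/
def roundPolicy (𝓑 : Finset (Policy S A)) {N : ℕ} (run : Fin N → S × A) (n : Fin N) :
    Kernel S A :=
  learnerPolicy 𝓑 fun i : Fin n => run (Fin.castLE n.isLt.le i)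

/-- `J(π̂)` for the output `π̂` of Stagger, the first-step uniform mixture of `π^1, …, π^N`. -/
def staggerReturn (M : EpisodicMDP S A) (𝓑 : Finset (Policy S A)) {N : ℕ}
    (run : Fin N → S × A) : ℝ :=
  M.expectedReturn (M.firstStepMixtureLaw (roundPolicy 𝓑 run))

/-- Online on-policy state-wise Hellinger estimation error
`∑_n 𝔼_{s ∼ d^{π^n}} D_H²(π^n(· | s), πE(· | s))`. -/
def onlineEstError (M : EpisodicMDP S A) (𝓑 : Finset (Policy S A)) (πE : Policy S A) {N : ℕ}
    (run : Fin N → S × A) : ℝ :=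
  ∑ n, ∫ s, hellingerSq (roundPolicy 𝓑 run n s) (πE.1 s)
    ∂(M.stateVisitation (roundPolicy 𝓑 run n))

end Stagger

end

-- Let e(s) be the expert's action and p_n = π^n(e(s^n) | s^n). The proof combines a likelihood
-- identity, a supermartingale and a performance difference inequality.
--
-- With log loss and learning rate 1, the weight of a base policy is its likelihood on the expert's
-- labels, so π^n is a Bayes mixture and p_n is the ratio of successive total weights. The product
-- telescopes (`prod_roundPolicy_mul_card`). The expert keeps weight 1, hence ∏ p_n ≥ 1/B: the
-- log-loss regret is at most log B.
--
-- For a point mass, D_H²(π^n(· | s), π^E(· | s)) = 2 - 2√π^n(e(s) | s) (`hellingerSq_dirac`). So if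
-- o_n is the mean of √π^n(e(s) | s) under d^{π^n}, the error of round n is D_n = 2 - 2 o_n, and o_n
-- = 1 - D_n/2 ≤ exp(-D_n/2). Given the past, √p_n has mean o_n, so ∏ √p_n / o_n is a nonnegative
-- supermartingale with mean at most 1 (`lintegral_overlapProduct_le`). By Markov's inequality it
-- stays below 1/δ with probability at least 1 - δ. There, B^{-1/2} exp(∑ D_n/2) < 1/δ, and
-- logarithms give the bound on ∑ D_n.
--
-- The returns are compared along the learner's own trajectories: each action that differs from the
-- expert's costs at most μ, so the gap for π^n is at most μH times the probability of a mistake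
-- under d^{π^n}. Pointwise this probability is 1 - p ≤ 2 - 2√p, the Hellinger error. Averaging over
-- rounds gives both claims.

attribute [instance] EpisodicMDP.init_prob EpisodicMDP.trans_markov EpisodicMDP.reward_markov

/-! ### Rollouts and additive functionals of trajectories -/

namespace EpisodicMDP

variable {S A : Type*} [MeasurableSpace S] [MeasurableSpace A]

theorem measurable_cons_step {k : ℕ} :
    Measurable fun x : (S × A) × unitInterval × (Fin k → Step S A) =>
      (Fin.cons (x.1.1, x.1.2, x.2.1) x.2.2 : Fin (k + 1) → Step S A) := by
  refine measurable_pi_iff.2 fun i => ?_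
  refine Fin.cases ?_ (fun j => ?_) i
  · simp only [Fin.cons_zero]
    fun_prop
  · simp only [Fin.cons_succ]
    fun_prop

instance isMarkovKernel_prependStep (M : EpisodicMDP S A) (h : ℕ) {k : ℕ}
    (κ : Kernel S (Fin k → Step S A)) [IsMarkovKernel κ] : IsMarkovKernel (M.prependStep h κ) :=
  Kernel.IsMarkovKernel.map _ measurable_cons_step

instance isFiniteKernel_prependStep (M : EpisodicMDP S A) (h : ℕ) {k : ℕ}
    (κ : Kernel S (Fin k → Step S A)) [IsFiniteKernel κ] : IsFiniteKernel (M.prependStep h κ) := by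
  unfold prependStep
  infer_instance

instance isMarkovKernel_rollout (M : EpisodicMDP S A) (π : Kernel S A) [IsMarkovKernel π] :
    ∀ k h, IsMarkovKernel (M.rollout π k h)
  | 0, _ => by
    unfold rollout
    infer_instance
  | k + 1, h => by
    have := isMarkovKernel_rollout M π k (h + 1)
    unfold rollout
    infer_instance

instance isFiniteKernel_rollout (M : EpisodicMDP S A) (π : Kernel S A) [IsFiniteKernel π] :
    ∀ k h, IsFiniteKernel (M.rollout π k h)
  | 0, _ => by
    unfold rollout
    infer_instance
  | k + 1, h => by
    have := isFiniteKernel_rollout M π k (h + 1)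
    unfold rollout
    infer_instance

instance isProbabilityMeasure_trajLaw (M : EpisodicMDP S A) (π : Kernel S A) [IsMarkovKernel π] :
    IsProbabilityMeasure (M.trajLaw π) := by
  unfold trajLaw
  infer_instance

theorem lintegral_prependStep (M : EpisodicMDP S A) (h : ℕ) {k : ℕ}
    (κ : Kernel S (Fin k → Step S A)) [IsSFiniteKernel κ] (x : S × A)
    {F : (Fin (k + 1) → Step S A) → ℝ≥0∞} (hF : Measurable F) :
    ∫⁻ τ, F τ ∂(M.prependStep h κ x) =
      ∫⁻ r, ∫⁻ s', ∫⁻ τ, F (Fin.cons (x.1, x.2, r) τ) ∂κ s' ∂M.trans h x ∂M.reward x := by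
  have hG : Measurable fun x : (S × A) × unitInterval × (Fin k → Step S A) =>
      F (Fin.cons (x.1.1, x.1.2, x.2.1) x.2.2) := hF.comp measurable_cons_step
  unfold prependStep
  rw [Kernel.lintegral_map _ measurable_cons_step _ hF, Kernel.lintegral_id_prod hG]
  refine (Kernel.lintegral_prod _ _ _ (hG.comp measurable_prodMk_left)).trans ?_
  refine lintegral_congr fun r => ?_
  rw [Kernel.lintegral_comp]
  · rfl
  · exact hG.comp (measurable_prodMk_left.comp measurable_prodMk_left)

theorem lintegral_rollout_succ (M : EpisodicMDP S A) (π : Kernel S A) [IsSFiniteKernel π]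
    (k h : ℕ) (s : S) {F : (Fin (k + 1) → Step S A) → ℝ≥0∞} (hF : Measurable F) :
    ∫⁻ τ, F τ ∂(M.rollout π (k + 1) h s) =
      ∫⁻ a, ∫⁻ τ, F τ ∂(M.prependStep h (M.rollout π k (h + 1)) (s, a)) ∂π s := by
  rw [rollout, Kernel.lintegral_comp _ _ _ hF,
    Kernel.lintegral_id_prod (Measurable.lintegral_kernel hF)]

/-- Expected total of the step function `f` over the `k` steps from step `h` on. -/
noncomputable def stepValue (M : EpisodicMDP S A) (π : Kernel S A) (f : Step S A → ℝ≥0∞)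
    (k h : ℕ) (s : S) : ℝ≥0∞ :=
  ∫⁻ τ, ∑ j, f (τ j) ∂(M.rollout π k h s)

/-- Expected total of the step function `f` over the `k + 1` steps from step `h` on, when the state
and the action of step `h` are given. -/
noncomputable def stepActionValue (M : EpisodicMDP S A) (π : Kernel S A) (f : Step S A → ℝ≥0∞)
    (k h : ℕ) (x : S × A) : ℝ≥0∞ :=
  ∫⁻ τ, ∑ j, f (τ j) ∂(M.prependStep h (M.rollout π k (h + 1)) x)

/-! ### Bellman recursions and performance difference for additive functionals. -/

section StepValue

variable (M : EpisodicMDP S A) (π : Kernel S A) {f : Step S A → ℝ≥0∞}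

theorem measurable_sum_step (hf : Measurable f) (k : ℕ) :
    Measurable fun τ : Fin k → Step S A => ∑ j, f (τ j) :=
  Finset.measurable_sum _ fun j _ => hf.comp (measurable_pi_apply j)

theorem measurable_stepValue (hf : Measurable f) (k h : ℕ) :
    Measurable (M.stepValue π f k h) :=
  Measurable.lintegral_kernel (measurable_sum_step hf k)

theorem measurable_stepActionValue (hf : Measurable f) (k h : ℕ) :
    Measurable (M.stepActionValue π f k h) :=
  Measurable.lintegral_kernel (measurable_sum_step hf (k + 1))

theorem stepValue_zero (h : ℕ) (s : S) : M.stepValue π f 0 h s = 0 := by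
  simp [stepValue]

theorem stepValue_succ [IsSFiniteKernel π] (hf : Measurable f) (k h : ℕ) (s : S) :
    M.stepValue π f (k + 1) h s = ∫⁻ a, M.stepActionValue π f k h (s, a) ∂π s :=
  M.lintegral_rollout_succ π k h s (measurable_sum_step hf (k + 1))

theorem stepActionValue_eq [IsMarkovKernel π] (hf : Measurable f) (k h : ℕ) (x : S × A) :
    M.stepActionValue π f k h x =
      ∫⁻ r, f (x.1, x.2, r) ∂M.reward x + ∫⁻ s', M.stepValue π f k (h + 1) s' ∂M.trans h x := by
  have hr : Measurable fun r : unitInterval => f (x.1, x.2, r) := by fun_prop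
  rw [stepActionValue, M.lintegral_prependStep h _ x (measurable_sum_step hf (k + 1))]
  simp only [Fin.sum_univ_succ, Fin.cons_zero, Fin.cons_succ]
  have inner : ∀ r : unitInterval, ∫⁻ s', ∫⁻ τ, f (x.1, x.2, r) + ∑ j, f (τ j)
      ∂(M.rollout π k (h + 1) s') ∂M.trans h x =
      f (x.1, x.2, r) + ∫⁻ s', M.stepValue π f k (h + 1) s' ∂M.trans h x := by
    intro r
    simp_rw [lintegral_add_left measurable_const, lintegral_const, measure_univ, mul_one]
    rw [lintegral_add_left measurable_const]
    simp [stepValue]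
  rw [lintegral_congr inner, lintegral_add_right _ measurable_const]
  simp

/-- Performance difference, in both directions: a policy whose one-step deviations from `π` cost
`c` loses at most the accumulated deviation costs. -/
theorem stepValue_le_add_stepValue {π π' : Kernel S A} [IsMarkovKernel π] [IsMarkovKernel π']
    {f : Step S A → ℝ≥0∞} (hf : Measurable f) {c : S × A → ℝ≥0∞} (hc : Measurable c) {H : ℕ}
    (hdev : ∀ k h, k + 1 + h = H → ∀ s a,
      M.stepValue π f (k + 1) h s ≤ M.stepActionValue π f k h (s, a) + c (s, a)) :
    ∀ k h, k + h = H → ∀ s, M.stepValue π f k h s ≤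
      M.stepValue π' f k h s + M.stepValue π' (fun x => ∫⁻ a, c (x.1, a) ∂π' x.1) k h s
  | 0, h, _, s => by simp [stepValue_zero]
  | k + 1, h, hk, s => by
    have ih := stepValue_le_add_stepValue (π' := π') hf hc hdev k (h + 1) (by omega)
    set C : Step S A → ℝ≥0∞ := fun x => ∫⁻ a, c (x.1, a) ∂π' x.1 with hC
    have hCm : Measurable C :=
      (Measurable.lintegral_kernel_prod_right' (κ := π') hc).comp measurable_fst
    have key : ∀ a, M.stepValue π f (k + 1) h s ≤
        (M.stepActionValue π' f k h (s, a) +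
          ∫⁻ s', M.stepValue π' C k (h + 1) s' ∂M.trans h (s, a)) + c (s, a) := by
      intro a
      -- Pay for one deviation at step `h`; from there both sides share reward and transition, and
      -- the induction hypothesis handles the remaining steps.
      refine (hdev k h hk s a).trans ?_
      gcongr
      rw [stepActionValue_eq M π hf, stepActionValue_eq M π' hf, add_assoc,
        ← lintegral_add_left (measurable_stepValue M π' hf k (h + 1))]
      gcongr with s'
      exact ih s'
    have hmC : Measurable fun a =>
        ∫⁻ s', M.stepValue π' C k (h + 1) s' ∂M.trans h (s, a) :=
      (Measurable.lintegral_kernel (κ := M.trans h) (measurable_stepValue M π' hCm k (h + 1))).comp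
        measurable_prodMk_left
    have hm1 : Measurable fun a => M.stepActionValue π' f k h (s, a) :=
      (measurable_stepActionValue M π' hf k h).comp measurable_prodMk_left
    calc M.stepValue π f (k + 1) h s = ∫⁻ _, M.stepValue π f (k + 1) h s ∂π' s := by simp
      _ ≤ _ := lintegral_mono key
      _ = _ := by
        rw [lintegral_add_right _ (by fun_prop), lintegral_add_left hm1, add_assoc,
          stepValue_succ M π' hf, stepValue_succ M π' hCm]
        congr 1
        simp_rw [stepActionValue_eq M π' hCm]
        rw [lintegral_add_right _ hmC, add_comm]
        simp [hC]

/-- Mirror image of the preceding bound, for deviations that gain at most `c`. The costs are again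
accumulated along `π'`, not along `π`; this is what later produces the learner's visitation
distribution. -/
theorem stepValue_le_stepValue_add {π π' : Kernel S A} [IsMarkovKernel π] [IsMarkovKernel π']
    {f : Step S A → ℝ≥0∞} (hf : Measurable f) {c : S × A → ℝ≥0∞} (hc : Measurable c) {H : ℕ}
    (hdev : ∀ k h, k + 1 + h = H → ∀ s a,
      M.stepActionValue π f k h (s, a) ≤ M.stepValue π f (k + 1) h s + c (s, a)) :
    ∀ k h, k + h = H → ∀ s, M.stepValue π' f k h s ≤
      M.stepValue π f k h s + M.stepValue π' (fun x => ∫⁻ a, c (x.1, a) ∂π' x.1) k h s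
  | 0, h, _, s => by simp [stepValue_zero]
  | k + 1, h, hk, s => by
    have ih := stepValue_le_stepValue_add (π' := π') hf hc hdev k (h + 1) (by omega)
    set C : Step S A → ℝ≥0∞ := fun x => ∫⁻ a, c (x.1, a) ∂π' x.1 with hC
    have hCm : Measurable C :=
      (Measurable.lintegral_kernel_prod_right' (κ := π') hc).comp measurable_fst
    have key : ∀ a, M.stepActionValue π' f k h (s, a) ≤
        (M.stepValue π f (k + 1) h s +
          ∫⁻ s', M.stepValue π' C k (h + 1) s' ∂M.trans h (s, a)) + c (s, a) := by
      intro a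
      calc _ ≤ M.stepActionValue π f k h (s, a) +
            ∫⁻ s', M.stepValue π' C k (h + 1) s' ∂M.trans h (s, a) := by
            rw [stepActionValue_eq M π hf, stepActionValue_eq M π' hf, add_assoc,
              ← lintegral_add_left (measurable_stepValue M π hf k (h + 1))]
            gcongr with s'
            exact ih s'
        _ ≤ _ := by
            rw [add_right_comm]
            gcongr
            exact hdev k h hk s a
    have hmC : Measurable fun a =>
        ∫⁻ s', M.stepValue π' C k (h + 1) s' ∂M.trans h (s, a) :=
      (Measurable.lintegral_kernel (κ := M.trans h) (measurable_stepValue M π' hCm k (h + 1))).comp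
        measurable_prodMk_left
    calc M.stepValue π' f (k + 1) h s = ∫⁻ a, M.stepActionValue π' f k h (s, a) ∂π' s :=
          stepValue_succ M π' hf k h s
      _ ≤ _ := lintegral_mono key
      _ = _ := by
        rw [lintegral_add_right _ (by fun_prop), lintegral_add_left measurable_const, add_assoc,
          stepValue_succ M π' hCm]
        simp_rw [stepActionValue_eq M π' hCm]
        rw [lintegral_add_right _ hmC, add_comm (lintegral _ _) (lintegral _ _)]
        simp [hC]

theorem stepValue_le [IsMarkovKernel π] {b : ℝ≥0∞} (hb : ∀ x, f x ≤ b) (k h : ℕ) (s : S) :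
    M.stepValue π f k h s ≤ k * b :=
  calc M.stepValue π f k h s ≤ ∫⁻ _, k * b ∂(M.rollout π k h s) := by
        refine lintegral_mono fun τ => ?_
        simpa using Finset.sum_le_card_nsmul Finset.univ (fun j => f (τ j)) b fun j _ => hb _
    _ = k * b := by simp

theorem stepActionValue_le [IsMarkovKernel π] {b : ℝ≥0∞} (hb : ∀ x, f x ≤ b) (k h : ℕ)
    (x : S × A) : M.stepActionValue π f k h x ≤ (k + 1 : ℕ) * b :=
  calc M.stepActionValue π f k h x
      ≤ ∫⁻ _, (k + 1 : ℕ) * b ∂(M.prependStep h (M.rollout π k (h + 1)) x) := by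
        refine lintegral_mono fun τ => ?_
        simpa using Finset.sum_le_card_nsmul Finset.univ (fun j => f (τ j)) b fun j _ => hb _
    _ = (k + 1 : ℕ) * b := by simp

theorem lintegral_trajLaw_sum (hf : Measurable f) :
    ∫⁻ τ, ∑ j, f (τ j) ∂(M.trajLaw π) = ∫⁻ s, M.stepValue π f M.horizon 0 s ∂M.init := by
  rw [trajLaw, Measure.lintegral_bind (Kernel.aemeasurable _)
    (measurable_sum_step hf _).aemeasurable]
  rfl

theorem lintegral_stateVisitation {g : S → ℝ≥0∞} (hg : Measurable g) :
    ∫⁻ s, g s ∂(M.stateVisitation π) =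
      (M.horizon : ℝ≥0∞)⁻¹ * ∫⁻ τ, ∑ j, g (τ j).1 ∂(M.trajLaw π) := by
  rw [stateVisitation, lintegral_smul_measure, lintegral_finsetSum_measure,
    lintegral_finsetSum _ fun j _ => by fun_prop, smul_eq_mul]
  congr 1
  refine Finset.sum_congr rfl fun j _ => ?_
  rw [lintegral_map hg (by fun_prop)]

theorem isProbabilityMeasure_stateVisitation [IsMarkovKernel π] (hH : 0 < M.horizon) :
    IsProbabilityMeasure (M.stateVisitation π) := by
  refine ⟨?_⟩
  have h := lintegral_stateVisitation M π (g := fun _ => 1) measurable_const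
  simp only [lintegral_const, one_mul, Finset.sum_const, Finset.card_univ, Fintype.card_fin,
    nsmul_eq_mul, mul_one, measure_univ] at h
  rw [h, ENNReal.inv_mul_cancel (by simpa using hH.ne') (by simp)]

instance isFiniteMeasure_stateVisitation [IsFiniteKernel π] :
    IsFiniteMeasure (M.stateVisitation π) := by
  -- For horizon 0 the factor `horizon⁻¹` is `∞`, but it multiplies an empty sum.
  rcases Nat.eq_zero_or_pos M.horizon with h0 | hH
  · have : IsEmpty (Fin M.horizon) := by rw [h0]; infer_instance
    rw [stateVisitation, Finset.univ_eq_empty, Finset.sum_empty, smul_zero]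
    infer_instance
  · have : IsFiniteMeasure (M.trajLaw π) := by unfold trajLaw; infer_instance
    refine ⟨?_⟩
    have h := lintegral_stateVisitation M π (g := fun _ => 1) measurable_const
    rw [lintegral_one] at h
    rw [h]
    refine ENNReal.mul_lt_top ?_ ?_
    · simpa using hH
    · simpa using ENNReal.mul_lt_top (ENNReal.natCast_lt_top _) (measure_lt_top _ _)

end StepValue

end EpisodicMDP

namespace EpisodicMDP

/-! ### Measurable dependence on the policy -/

section Parametric

variable {S A X : Type*} [MeasurableSpace S] [MeasurableSpace A] [MeasurableSpace X]
  (M : EpisodicMDP S A)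

/-- The learner's policy is the zero kernel on histories where every weight vanishes. Measurability
in the history must cover these too, so the bounds here are for sub-Markov policies. -/
theorem rollout_univ_le_one {π : Kernel S A} [IsFiniteKernel π]
    (hle : ∀ s, π s Set.univ ≤ 1) : ∀ k h s, M.rollout π k h s Set.univ ≤ 1
  | 0, h, s => by simp [rollout]
  | k + 1, h, s => by
    rw [← lintegral_one, M.lintegral_rollout_succ π k h s measurable_const]
    refine (lintegral_mono (g := fun _ => 1) fun a => ?_).trans (by simpa using hle s)
    rw [M.lintegral_prependStep h _ _ measurable_const]
    simp only [lintegral_const, one_mul]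
    calc _ ≤ (∫⁻ _, 1 ∂M.trans h (s, a)) * M.reward (s, a) Set.univ := by
          gcongr
          exact rollout_univ_le_one hle k (h + 1) _
      _ ≤ 1 := by simp

/-- Each round's policy depends on the random past, so integrating over a run requires joint
measurability in parameter and state. Unrolling one step turns the law into iterated integrals
against kernels that carry the parameter along. -/
theorem measurable_rollout_param {p : X → Kernel S A} [∀ x, IsFiniteKernel (p x)]
    (hp : Measurable fun z : X × S => p z.1 z.2) (hle : ∀ x s, p x s Set.univ ≤ 1) :
    ∀ k h, Measurable fun z : X × S => M.rollout (p z.1) k h z.2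
  | 0, h => by
    simp only [rollout, Kernel.const_apply]
    exact measurable_const
  | k + 1, h => by
    let κ : Kernel (X × S) A := ⟨_, hp⟩
    let ρ : Kernel (X × S) (Fin k → Step S A) :=
      ⟨_, measurable_rollout_param hp hle k (h + 1)⟩
    have : IsFiniteKernel κ := ⟨⟨1, ENNReal.one_lt_top, fun z => hle _ _⟩⟩
    have : IsFiniteKernel ρ :=
      ⟨⟨1, ENNReal.one_lt_top, fun z => M.rollout_univ_le_one (hle _) _ _ _⟩⟩
    refine Measure.measurable_of_measurable_coe _ fun B hB => ?_
    have hF : Measurable (B.indicator (1 : (Fin (k + 1) → Step S A) → ℝ≥0∞)) :=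
      measurable_one.indicator hB
    have hcons : Measurable fun w : ((((X × S) × A) × unitInterval) × S) × (Fin k → Step S A) =>
        B.indicator (1 : (Fin (k + 1) → Step S A) → ℝ≥0∞)
          (Fin.cons (w.1.1.1.1.2, w.1.1.1.2, w.1.1.2) w.2) :=
      (hF.comp measurable_cons_step).comp (f := fun w :
        ((((X × S) × A) × unitInterval) × S) × (Fin k → Step S A) =>
        (((w.1.1.1.1.2, w.1.1.1.2), w.1.1.2, w.2) :
          (S × A) × unitInterval × (Fin k → Step S A))) (by fun_prop)
    have h1 := Measurable.lintegral_kernel_prod_right' (κ := ρ.comap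
      (fun w : (((X × S) × A) × unitInterval) × S => (w.1.1.1.1, w.2)) (by fun_prop)) hcons
    have h2 := Measurable.lintegral_kernel_prod_right' (κ := (M.trans h).comap
      (fun w : ((X × S) × A) × unitInterval => (w.1.1.2, w.1.2)) (by fun_prop)) h1
    have h3 := Measurable.lintegral_kernel_prod_right' (κ := M.reward.comap
      (fun w : (X × S) × A => (w.1.2, w.2)) (by fun_prop)) h2
    have h4 := Measurable.lintegral_kernel_prod_right' (κ := κ) h3
    convert h4 using 2 with z
    rw [← lintegral_indicator_one hB, M.lintegral_rollout_succ _ k h z.2 hF]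
    refine lintegral_congr fun a => ?_
    rw [M.lintegral_prependStep h _ _ hF]
    rfl

theorem measurable_trajLaw_param {p : X → Kernel S A} [∀ x, IsFiniteKernel (p x)]
    (hp : Measurable fun z : X × S => p z.1 z.2) (hle : ∀ x s, p x s Set.univ ≤ 1) :
    Measurable fun x => M.trajLaw (p x) := by
  let ρ : Kernel (X × S) (Fin M.horizon → Step S A) :=
    ⟨_, M.measurable_rollout_param hp hle M.horizon 0⟩
  refine Measure.measurable_of_measurable_coe _ fun B hB => ?_
  have h := (ρ.measurable_coe hB).lintegral_prod_right' (ν := M.init)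
  convert h using 2 with x
  rw [trajLaw, Measure.bind_apply hB (Kernel.aemeasurable _)]
  rfl

theorem measurable_stateVisitation_param {p : X → Kernel S A} [∀ x, IsFiniteKernel (p x)]
    (hp : Measurable fun z : X × S => p z.1 z.2) (hle : ∀ x s, p x s Set.univ ≤ 1) :
    Measurable fun x => M.stateVisitation (p x) := by
  have ht := M.measurable_trajLaw_param hp hle
  refine Measure.measurable_of_measurable_coe _ fun B hB => ?_
  have : ∀ x, M.stateVisitation (p x) B = (M.horizon : ℝ≥0∞)⁻¹ *
      ∑ j : Fin M.horizon, M.trajLaw (p x) ((fun τ => (τ j).1) ⁻¹' B) := by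
    intro x
    rw [stateVisitation, Measure.smul_apply, Measure.finsetSum_apply, smul_eq_mul]
    congr 1
    exact Finset.sum_congr rfl fun j _ => Measure.map_apply (by fun_prop) hB
  simp_rw [this]
  refine Measurable.const_mul (Finset.measurable_sum _ fun j _ => ?_) _
  exact (Measure.measurable_coe ((by fun_prop :
    Measurable fun τ : Fin M.horizon → Step S A => (τ j).1) hB)).comp ht

theorem stateVisitation_univ_le_one {π : Kernel S A} [IsFiniteKernel π]
    (hle : ∀ s, π s Set.univ ≤ 1) : M.stateVisitation π Set.univ ≤ 1 := by
  have h1 : M.trajLaw π Set.univ ≤ 1 := by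
    rw [trajLaw, Measure.bind_apply .univ (Kernel.aemeasurable _)]
    calc _ ≤ ∫⁻ _, 1 ∂M.init := lintegral_mono fun s => M.rollout_univ_le_one hle _ _ s
      _ = 1 := by simp
  have h := lintegral_stateVisitation M π (g := fun _ => 1) measurable_const
  rw [lintegral_one] at h
  rw [h]
  simp only [lintegral_const, Finset.sum_const, Finset.card_univ, Fintype.card_fin,
    nsmul_eq_mul, mul_one]
  rw [← mul_assoc]
  exact mul_le_one' (ENNReal.inv_mul_le_one _) h1

end Parametric

end EpisodicMDP

/-! ### Hellinger distance to a point mass -/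

/-- Expanding the square leaves the cross term ∫ √f√g. The density of the point mass vanishes off
`e`, so this integral lives on the atom and equals √(P{e} · 1). -/
theorem hellingerSq_dirac {A : Type*} [MeasurableSpace A] [MeasurableSingletonClass A]
    (P : Measure A) [IsProbabilityMeasure P] (e : A) :
    hellingerSq P (Measure.dirac e) = 2 - 2 * √(P {e}).toReal := by
  set Q : Measure A := Measure.dirac e with hQ
  set ω : Measure A := P + Q with hω
  have hP : P ≪ ω := (Measure.le_add_right le_rfl).absolutelyContinuous
  have hQω : Q ≪ ω := (Measure.le_add_left le_rfl).absolutelyContinuous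
  have hsupp : ∀ᵐ x ∂ω, x ≠ e → Q.rnDeriv ω x = 0 := by
    have h0 : ∫⁻ x in {e}ᶜ, Q.rnDeriv ω x ∂ω = 0 := by
      rw [Measure.setLIntegral_rnDeriv hQω, hQ]
      simp
    rw [lintegral_eq_zero_iff (Measure.measurable_rnDeriv _ _)] at h0
    exact (ae_restrict_iff' (measurableSet_singleton e).compl).1 h0
  have hpt : ∀ ν : Measure A, IsFiniteMeasure ν → ν ≪ ω →
      ω.real {e} * (ν.rnDeriv ω e).toReal = ν.real {e} := by
    intro ν _ hν
    rw [← Measure.setIntegral_toReal_rnDeriv hν {e}, integral_singleton, smul_eq_mul]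
  have hprod : (fun x => √(P.rnDeriv ω x).toReal * √(Q.rnDeriv ω x).toReal) =ᵐ[ω]
      ({e} : Set A).indicator
        fun _ => √(P.rnDeriv ω e).toReal * √(Q.rnDeriv ω e).toReal := by
    filter_upwards [hsupp] with x hx
    by_cases hxe : x = e
    · simp [hxe]
    · simp [hxe, hx hxe]
  have hprodint : ∫ x, √(P.rnDeriv ω x).toReal * √(Q.rnDeriv ω x).toReal ∂ω =
      √(P {e}).toReal := by
    rw [integral_congr_ae hprod, integral_indicator_const _ (measurableSet_singleton e),
      smul_eq_mul]
    have hQe : Q.real {e} = 1 := by simp [hQ, Measure.real]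
    calc ω.real {e} * (√(P.rnDeriv ω e).toReal * √(Q.rnDeriv ω e).toReal)
        = √(ω.real {e} * (P.rnDeriv ω e).toReal) *
          √(ω.real {e} * (Q.rnDeriv ω e).toReal) := by
          rw [Real.sqrt_mul measureReal_nonneg, Real.sqrt_mul measureReal_nonneg]
          -- Split ω{e} into two square roots, one for each density.
          nth_rewrite 1 [← Real.mul_self_sqrt (measureReal_nonneg (μ := ω) (s := {e}))]
          ring
      _ = √(P {e}).toReal := by
          rw [hpt P inferInstance hP, hpt Q inferInstance hQω, hQe, Real.sqrt_one, mul_one]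
          rfl
  have hprodi : Integrable
      (fun x => √(P.rnDeriv ω x).toReal * √(Q.rnDeriv ω x).toReal) ω :=
    ((integrable_const _).indicator (measurableSet_singleton e)).congr hprod.symm
  have hPi : Integrable (fun x => (P.rnDeriv ω x).toReal) ω :=
    Measure.integrable_toReal_rnDeriv
  have hQi : Integrable (fun x => (Q.rnDeriv ω x).toReal) ω :=
    Measure.integrable_toReal_rnDeriv
  have hexp : ∀ x, (√(P.rnDeriv ω x).toReal - √(Q.rnDeriv ω x).toReal) ^ 2 =
      (P.rnDeriv ω x).toReal + (Q.rnDeriv ω x).toReal -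
        2 * (√(P.rnDeriv ω x).toReal * √(Q.rnDeriv ω x).toReal) := by
    intro x
    rw [sub_sq, Real.sq_sqrt ENNReal.toReal_nonneg, Real.sq_sqrt ENNReal.toReal_nonneg]
    ring
  unfold hellingerSq
  simp_rw [← hω, hexp]
  rw [integral_sub (by exact hPi.add hQi) (hprodi.const_mul 2), integral_add hPi hQi,
    integral_const_mul, hprodint, Measure.integral_toReal_rnDeriv hP,
    Measure.integral_toReal_rnDeriv hQω]
  simp [hQ]
  norm_num

/-! ### Exponential weights -/

section Weights

/-- The past agrees with the deterministic annotator `e`. -/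
def Annotated {S A : Type*} (e : S → A) {n : ℕ} (hist : Fin n → S × A) : Prop :=
  ∀ i, (hist i).2 = e (hist i).1

theorem Annotated.init {S A : Type*} {e : S → A} {n : ℕ}
    {run : Fin (n + 1) → S × A} (h : Annotated e run) :
    Annotated e (Fin.init run : Fin n → S × A) := fun i => h i.castSucc

theorem Annotated.castLE {S A : Type*} {e : S → A} {N : ℕ} {run : Fin N → S × A}
    (h : Annotated e run) {n : ℕ} (hn : n ≤ N) : Annotated e fun i : Fin n => run (Fin.castLE hn i) := fun _ => h _


variable {S A : Type*} [MeasurableSpace S] [MeasurableSpace A]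

/-- The set {x.2} is the section of the diagonal; this is where measurability of the diagonal of the
action space enters. -/
theorem measurable_kernel_singleton [MeasurableEq A] {X : Type*} [MeasurableSpace X]
    (κ : Kernel X A) [IsSFiniteKernel κ] : Measurable fun x : X × A => κ x.1 {x.2} := by
  have ht : MeasurableSet {p : (X × A) × A | p.1.2 = p.2} :=
    measurableSet_eq_fun (by fun_prop) (by fun_prop)
  have h := Kernel.measurable_kernel_prodMk_left
    (κ := κ.comap (Prod.fst : X × A → X) measurable_fst) ht
  convert h using 2 with x
  rw [Kernel.comap_apply]
  congr 1
  ext a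
  exact eq_comm

theorem Policy.singleton_le_one (π : Policy S A) (s : S) (E : Set A) : π.1 s E ≤ 1 := by
  have := π.2
  exact prob_le_one

theorem EReal.exp_sum {ι : Type*} (t : Finset ι) (f : ι → EReal) :
    EReal.exp (∑ i ∈ t, f i) = ∏ i ∈ t, EReal.exp (f i) := by
  classical
  induction t using Finset.induction_on with
  | empty => simp
  | insert i t hi ih => rw [Finset.sum_insert hi, Finset.prod_insert hi, EReal.exp_add, ih]

/-- At learning rate 1, exponentiated log losses are likelihoods. Infinite losses are harmless
because the probabilities are finite, which lets the inverse pass through the product. -/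
theorem expWeight_eq_prod {n : ℕ} (hist : Fin n → S × A) (π : Policy S A) :
    expWeight hist π = ∏ i, π.1 (hist i).1 {(hist i).2} := by
  unfold expWeight logLoss
  simp only [EReal.exp_neg, EReal.exp_sum, ENNReal.exp_log, one_div]
  rw [ENNReal.prod_inv_distrib]
  · simp
  · intro i _ j _ _
    left
    simpa using ((π.singleton_le_one _ _).trans_lt ENNReal.one_lt_top).ne

variable (𝓑 : Finset (Policy S A))

theorem expWeight_le_one {n : ℕ} (hist : Fin n → S × A) (π : Policy S A) :
    expWeight hist π ≤ 1 := by
  rw [expWeight_eq_prod]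
  exact Finset.prod_le_one' fun i _ => π.singleton_le_one _ _

theorem sum_expWeight_ne_top {n : ℕ} (hist : Fin n → S × A) :
    ∑ π ∈ 𝓑, expWeight hist π ≠ ∞ :=
  ENNReal.sum_ne_top.2 fun π _ => ((expWeight_le_one hist π).trans_lt ENNReal.one_lt_top).ne

theorem sum_expWeightsDist {n : ℕ} (hist : Fin n → S × A) :
    ∑ π ∈ 𝓑, expWeightsDist 𝓑 hist π =
      (∑ π ∈ 𝓑, expWeight hist π) / ∑ π ∈ 𝓑, expWeight hist π := by
  simp only [expWeightsDist, div_eq_mul_inv, Finset.sum_mul]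

theorem learnerPolicy_apply {n : ℕ} (hist : Fin n → S × A) (s : S) (E : Set A) :
    learnerPolicy 𝓑 hist s E = ∑ π ∈ 𝓑, expWeightsDist 𝓑 hist π * π.1 s E := by
  change (∑ π ∈ 𝓑, expWeightsDist 𝓑 hist π • π.1 s) E = _
  simp [Measure.finsetSum_apply]

theorem learnerPolicy_univ {n : ℕ} (hist : Fin n → S × A) (s : S) :
    learnerPolicy 𝓑 hist s Set.univ =
      (∑ π ∈ 𝓑, expWeight hist π) / ∑ π ∈ 𝓑, expWeight hist π := by
  rw [learnerPolicy_apply, ← sum_expWeightsDist]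
  refine Finset.sum_congr rfl fun π _ => ?_
  have := π.2
  simp

theorem learnerPolicy_univ_le_one {n : ℕ} (hist : Fin n → S × A) (s : S) :
    learnerPolicy 𝓑 hist s Set.univ ≤ 1 := by
  rw [learnerPolicy_univ]
  exact ENNReal.div_self_le_one

instance isFiniteKernel_learnerPolicy {n : ℕ} (hist : Fin n → S × A) :
    IsFiniteKernel (learnerPolicy 𝓑 hist) :=
  ⟨⟨1, ENNReal.one_lt_top, learnerPolicy_univ_le_one 𝓑 hist⟩⟩

theorem isMarkovKernel_learnerPolicy {n : ℕ} {hist : Fin n → S × A}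
    (h : ∑ π ∈ 𝓑, expWeight hist π ≠ 0) : IsMarkovKernel (learnerPolicy 𝓑 hist) :=
  ⟨fun s => ⟨by rw [learnerPolicy_univ, ENNReal.div_self h (sum_expWeight_ne_top 𝓑 hist)]⟩⟩

theorem measurable_expWeight [MeasurableEq A] {n : ℕ} (π : Policy S A) :
    Measurable fun hist : Fin n → S × A => expWeight hist π := by
  have := π.2
  simp_rw [expWeight_eq_prod]
  exact Finset.measurable_prod _ fun i _ =>
    (measurable_kernel_singleton π.1).comp (measurable_pi_apply i)

theorem measurable_expWeightsDist [MeasurableEq A] {n : ℕ} (π : Policy S A) :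
    Measurable fun hist : Fin n → S × A => expWeightsDist 𝓑 hist π :=
  (measurable_expWeight π).div (Finset.measurable_sum _ fun π' _ => measurable_expWeight π')

theorem measurable_learnerPolicy [MeasurableEq A] {n : ℕ} :
    Measurable fun z : (Fin n → S × A) × S => learnerPolicy 𝓑 z.1 z.2 := by
  refine Measure.measurable_of_measurable_coe _ fun E hE => ?_
  simp_rw [learnerPolicy_apply]
  exact Finset.measurable_sum _ fun π _ =>
    ((measurable_expWeightsDist 𝓑 π).comp measurable_fst).mul
      ((π.1.measurable_coe hE).comp measurable_snd)

/-- The policy of the next round, jointly as a kernel in the past and the state. -/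
noncomputable def learnerKernel [MeasurableEq A] (n : ℕ) : Kernel ((Fin n → S × A) × S) A :=
  ⟨_, measurable_learnerPolicy 𝓑⟩

instance [MeasurableEq A] (n : ℕ) : IsFiniteKernel (learnerKernel 𝓑 n) :=
  ⟨⟨1, ENNReal.one_lt_top, fun z => learnerPolicy_univ_le_one 𝓑 z.1 z.2⟩⟩

/-- Law of the state sampled in the next round, as a kernel in the past. -/
noncomputable def visitationKernel [MeasurableEq A] (M : EpisodicMDP S A) (n : ℕ) :
    Kernel (Fin n → S × A) S :=
  ⟨fun hist => M.stateVisitation (learnerPolicy 𝓑 hist), M.measurable_stateVisitation_param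
    (measurable_learnerPolicy 𝓑) (learnerPolicy_univ_le_one 𝓑)⟩

instance [MeasurableEq A] (M : EpisodicMDP S A) (n : ℕ) :
    IsFiniteKernel (visitationKernel 𝓑 M n) :=
  ⟨⟨1, ENNReal.one_lt_top, fun hist =>
    M.stateVisitation_univ_le_one (learnerPolicy_univ_le_one 𝓑 hist)⟩⟩

variable {𝓑}

/-- The expert assigns likelihood 1 to its own labels. -/
theorem one_le_sum_expWeight {πE : Policy S A} (hmem : πE ∈ 𝓑) {e : S → A}
    (he : ∀ s, πE.1 s = Measure.dirac (e s)) {n : ℕ} {hist : Fin n → S × A}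
    (h : Annotated e hist) : 1 ≤ ∑ π ∈ 𝓑, expWeight hist π := by
  refine le_trans ?_ (Finset.single_le_sum (f := fun π => expWeight hist π)
    (fun _ _ => zero_le) hmem)
  rw [expWeight_eq_prod]
  refine (Finset.prod_eq_one fun i _ => ?_).ge
  rw [he, h i, Measure.dirac_apply_of_mem (Set.mem_singleton _)]

/-- The Bayes predictive probability: averaging the next-label probabilities with the current
weights yields the next total weight. -/
theorem learnerPolicy_singleton_mul {n : ℕ} {hist : Fin n → S × A}
    (h : ∑ π ∈ 𝓑, expWeight hist π ≠ 0) (x : S × A) :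
    learnerPolicy 𝓑 hist x.1 {x.2} * ∑ π ∈ 𝓑, expWeight hist π =
      ∑ π ∈ 𝓑, expWeight (Fin.snoc hist x : Fin (n + 1) → S × A) π := by
  rw [learnerPolicy_apply, Finset.sum_mul]
  refine Finset.sum_congr rfl fun π _ => ?_
  rw [mul_right_comm, expWeightsDist, ENNReal.div_mul_cancel h (sum_expWeight_ne_top 𝓑 hist),
    expWeight_eq_prod, expWeight_eq_prod, Fin.prod_univ_castSucc]
  simp

/-- The likelihoods of the successive mixtures telescope to the total weight. -/
theorem prod_roundPolicy_mul_card {πE : Policy S A} (hmem : πE ∈ 𝓑) {e : S → A}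
    (he : ∀ s, πE.1 s = Measure.dirac (e s)) :
    ∀ {N : ℕ} {run : Fin N → S × A}, Annotated e run →
      (∏ n, roundPolicy 𝓑 run n (run n).1 {(run n).2}) * 𝓑.card =
        ∑ π ∈ 𝓑, expWeight run π
  | 0, run, _ => by simp [expWeight_eq_prod]
  | N + 1, run, h => by
    have ih := prod_roundPolicy_mul_card hmem he h.init
    have h0 : ∑ π ∈ 𝓑, expWeight (Fin.init run : Fin N → S × A) π ≠ 0 :=
      (zero_lt_one.trans_le (one_le_sum_expWeight hmem he h.init)).ne'
    have hs := learnerPolicy_singleton_mul h0 (run (Fin.last N))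
    rw [Fin.snoc_init_self] at hs
    rw [← hs, ← ih, Fin.prod_univ_castSucc, mul_right_comm, mul_comm]
    rfl

end Weights

/-! ### The law of a run -/

section RunLaw

variable {S A : Type*} [MeasurableSpace S] [MeasurableSpace A]

theorem measurable_snoc_step {X : Type*} [MeasurableSpace X] {n : ℕ} :
    Measurable fun z : (Fin n → X) × X => (Fin.snoc z.1 z.2 : Fin (n + 1) → X) := by
  refine measurable_pi_iff.2 fun i => ?_
  refine Fin.lastCases ?_ (fun j => ?_) i
  · simp only [Fin.snoc_last]
    fun_prop
  · simp only [Fin.snoc_castSucc]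
    fun_prop

/-- The preimage of a measurable `E` under `e` is the set where the measurable function `πE s E`
equals 1. -/
theorem measurable_annotator {πE : Kernel S A} {e : S → A}
    (he : ∀ s, πE s = Measure.dirac (e s)) : Measurable e := by
  intro E hE
  have h := πE.measurable_coe hE (measurableSet_singleton (1 : ℝ≥0∞))
  convert h using 1
  ext s
  by_cases hs : e s ∈ E <;> simp [he, Measure.dirac_apply' _ hE, hs]

theorem measurableSet_annotated [MeasurableEq A] {e : S → A} (hem : Measurable e) (n : ℕ) :
    MeasurableSet {hist : Fin n → S × A | Annotated e hist} := by
  have hiInter : {hist : Fin n → S × A | Annotated e hist} =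
      ⋂ i, {hist | (hist i).2 = e (hist i).1} := by
    ext
    simp [Annotated]
  rw [hiInter]
  exact MeasurableSet.iInter fun i => measurableSet_eq_fun (by fun_prop) (by fun_prop)

variable (M : EpisodicMDP S A) (𝓑 : Finset (Policy S A)) {πE : Policy S A} {e : S → A}

/-- Bhattacharyya overlap of the learner's next policy and the annotator, averaged over the states
that the learner visits. -/
noncomputable def overlap (e : S → A) {n : ℕ} (hist : Fin n → S × A) : ℝ≥0∞ :=
  ∫⁻ s, (learnerPolicy 𝓑 hist s {e s}) ^ (1 / 2 : ℝ) ∂(M.stateVisitation (learnerPolicy 𝓑 hist))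

/-- Increment of the multiplicative supermartingale that controls the run. -/
noncomputable def overlapRatio (e : S → A) {n : ℕ} (hist : Fin n → S × A) (x : S × A) : ℝ≥0∞ :=
  (learnerPolicy 𝓑 hist x.1 {x.2}) ^ (1 / 2 : ℝ) / overlap M 𝓑 e hist

/-- Multiplicative supermartingale of a run. -/
noncomputable def overlapProduct (e : S → A) {N : ℕ} (run : Fin N → S × A) : ℝ≥0∞ :=
  ∏ n : Fin N, overlapRatio M 𝓑 e (fun i : Fin n => run (Fin.castLE n.isLt.le i)) (run n)

theorem overlapProduct_snoc {n : ℕ} (hist : Fin n → S × A) (x : S × A) :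
    overlapProduct M 𝓑 e (Fin.snoc hist x : Fin (n + 1) → S × A) =
      overlapProduct M 𝓑 e hist * overlapRatio M 𝓑 e hist x := by
  have hpre : ∀ (m : ℕ) (hm : m ≤ n), (fun i : Fin m => (Fin.snoc hist x : Fin (n + 1) → S × A)
      (Fin.castLE (hm.trans n.le_succ) i)) = fun i : Fin m => hist (Fin.castLE hm i) := by
    intro m hm
    funext i
    exact Fin.snoc_castSucc (α := fun _ => S × A) x hist (Fin.castLE hm i)
  rw [overlapProduct, Fin.prod_univ_castSucc, overlapProduct]
  congr 1
  · refine Finset.prod_congr rfl fun i _ => ?_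
    rw [Fin.snoc_castSucc]
    exact congrArg (fun q => overlapRatio M 𝓑 e q (hist i)) (hpre i i.isLt.le)
  · rw [Fin.snoc_last]
    exact congrArg (fun q => overlapRatio M 𝓑 e q x) (hpre n le_rfl)

variable [MeasurableEq A]

theorem lintegral_staggerLaw_succ (he : ∀ s, πE.1 s = Measure.dirac (e s)) (n : ℕ)
    {F : (Fin (n + 1) → S × A) → ℝ≥0∞} (hF : Measurable F) :
    ∫⁻ run, F run ∂(staggerLaw M 𝓑 πE (n + 1)) =
      ∫⁻ hist, ∫⁻ s, F (Fin.snoc hist (s, e s)) ∂(visitationKernel 𝓑 M n hist)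
        ∂(staggerLaw M 𝓑 πE n) := by
  have := πE.2
  have hsnoc : ∀ hist : Fin n → S × A,
      Measurable fun x : S × A => (Fin.snoc hist x : Fin (n + 1) → S × A) := fun hist =>
    measurable_snoc_step.comp measurable_prodMk_left
  have hlaw : ∀ (hist : Fin n → S × A) {G : (Fin (n + 1) → S × A) → ℝ≥0∞}, Measurable G →
      ∫⁻ x, G x ∂((M.stateVisitation (learnerPolicy 𝓑 hist) ⊗ₘ πE.1).map
        fun x => (Fin.snoc hist x : Fin (n + 1) → S × A)) =
      ∫⁻ s, G (Fin.snoc hist (s, e s)) ∂(visitationKernel 𝓑 M n hist) := by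
    intro hist G hG
    rw [lintegral_map hG (hsnoc hist)]
    refine (Measure.lintegral_compProd (hG.comp (hsnoc hist))).trans ?_
    refine lintegral_congr fun s => ?_
    rw [he]
    exact lintegral_dirac' _ (hG.comp ((hsnoc hist).comp measurable_prodMk_left))
  have hmeas : Measurable fun hist : Fin n → S × A =>
      (M.stateVisitation (learnerPolicy 𝓑 hist) ⊗ₘ πE.1).map
        fun x => (Fin.snoc hist x : Fin (n + 1) → S × A) := by
    refine Measure.measurable_of_measurable_coe _ fun B hB => ?_
    have hi : Measurable (B.indicator (1 : (Fin (n + 1) → S × A) → ℝ≥0∞)) :=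
      measurable_one.indicator hB
    simp_rw [← lintegral_indicator_one hB, hlaw _ hi]
    have hem := measurable_annotator he
    exact Measurable.lintegral_kernel_prod_right' (f := fun z : (Fin n → S × A) × S =>
      B.indicator (1 : (Fin (n + 1) → S × A) → ℝ≥0∞) (Fin.snoc z.1 (z.2, e z.2)))
      (hi.comp (measurable_snoc_step.comp (by fun_prop :
        Measurable fun z : (Fin n → S × A) × S => (z.1, (z.2, e z.2)))))
  rw [staggerLaw, Measure.lintegral_bind hmeas.aemeasurable hF.aemeasurable]
  exact lintegral_congr fun hist => hlaw hist hF

variable {𝓑}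

theorem isProbabilityMeasure_visitationKernel (hH : 0 < M.horizon) (hmem : πE ∈ 𝓑)
    (he : ∀ s, πE.1 s = Measure.dirac (e s)) {n : ℕ} {hist : Fin n → S × A}
    (h : Annotated e hist) : IsProbabilityMeasure (visitationKernel 𝓑 M n hist) := by
  have := isMarkovKernel_learnerPolicy 𝓑
    (zero_lt_one.trans_le (one_le_sum_expWeight hmem he h)).ne'
  exact M.isProbabilityMeasure_stateVisitation (learnerPolicy 𝓑 hist) hH

/-- While the labels are the expert's, the total weight is at least 1, so the learner is Markov and
the next state law has mass one; the new label is again the expert's. No mass is lost in the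
induction. -/
theorem staggerLaw_annotated (hH : 0 < M.horizon) (hmem : πE ∈ 𝓑)
    (he : ∀ s, πE.1 s = Measure.dirac (e s)) :
    ∀ n, staggerLaw M 𝓑 πE n {run | Annotated e run} = 1
  | 0 => by
    rw [staggerLaw, Measure.dirac_apply_of_mem]
    exact fun i => i.elim0
  | n + 1 => by
    have hem := measurable_annotator he
    have hA := measurableSet_annotated hem n
    have hA' := measurableSet_annotated hem (n + 1)
    rw [← lintegral_indicator_one hA',
      lintegral_staggerLaw_succ M 𝓑 he n (measurable_one.indicator hA'),
      ← staggerLaw_annotated hH hmem he n, ← lintegral_indicator_one hA]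
    refine lintegral_congr fun hist => ?_
    have hiff : ∀ s, Annotated e (Fin.snoc hist (s, e s) : Fin (n + 1) → S × A) ↔
        Annotated e hist := by
      intro s
      simp [Annotated, Fin.forall_fin_succ']
    by_cases h : Annotated e hist
    · have := isProbabilityMeasure_visitationKernel M hH hmem he h
      simp [Set.indicator, hiff, h]
    · simp [Set.indicator, hiff, h]

variable (𝓑)

theorem measurable_overlapRatio (hem : Measurable e) (n : ℕ) :
    Measurable fun z : (Fin n → S × A) × (S × A) => overlapRatio M 𝓑 e z.1 z.2 := by
  have hp : Measurable fun z : ((Fin n → S × A) × S) × A => learnerPolicy 𝓑 z.1.1 z.1.2 {z.2} :=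
    measurable_kernel_singleton (learnerKernel 𝓑 n)
  have h1 : Measurable fun z : (Fin n → S × A) × (S × A) =>
      (learnerPolicy 𝓑 z.1 z.2.1 {z.2.2}) ^ (1 / 2 : ℝ) :=
    (hp.comp (by fun_prop : Measurable fun z : (Fin n → S × A) × (S × A) =>
      ((z.1, z.2.1), z.2.2))).pow_const _
  have h2 : Measurable fun hist : Fin n → S × A => overlap M 𝓑 e hist :=
    Measurable.lintegral_kernel_prod_right' (κ := visitationKernel 𝓑 M n)
      ((hp.comp (by fun_prop : Measurable fun z : (Fin n → S × A) × S =>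
        ((z.1, z.2), e z.2))).pow_const _)
  exact h1.div (h2.comp measurable_fst)

theorem measurable_overlapProduct (hem : Measurable e) (N : ℕ) :
    Measurable fun run : Fin N → S × A => overlapProduct M 𝓑 e run :=
  Finset.measurable_prod _ fun n _ => (measurable_overlapRatio M 𝓑 hem n).comp
    (f := fun run : Fin N → S × A => (fun i : Fin n => run (Fin.castLE n.isLt.le i), run n))
    (by fun_prop)

/-- Given the past, the numerator of the next ratio integrates to `overlap`, so the conditional mean
is `overlap / overlap`: 1, or 0 when the overlap vanishes. -/
theorem lintegral_overlapProduct_le (he : ∀ s, πE.1 s = Measure.dirac (e s)) :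
    ∀ n, ∫⁻ run, overlapProduct M 𝓑 e run ∂(staggerLaw M 𝓑 πE n) ≤ 1
  | 0 => by
    simp [overlapProduct, staggerLaw]
  | n + 1 => by
    have hem := measurable_annotator he
    rw [lintegral_staggerLaw_succ M 𝓑 he n (measurable_overlapProduct M 𝓑 hem _)]
    refine le_trans (lintegral_mono fun hist => ?_) (lintegral_overlapProduct_le he n)
    have hr : Measurable fun s => overlapRatio M 𝓑 e hist (s, e s) :=
      (measurable_overlapRatio M 𝓑 hem n).comp (f := fun s => (hist, (s, e s))) (by fun_prop)
    have hq : Measurable fun s => (learnerPolicy 𝓑 hist s {e s}) ^ (1 / 2 : ℝ) :=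
      ((measurable_kernel_singleton (learnerPolicy 𝓑 hist)).comp
        (f := fun s => (s, e s)) (by fun_prop)).pow_const _
    simp_rw [overlapProduct_snoc]
    rw [lintegral_const_mul _ hr]
    refine mul_le_of_le_one_right' ?_
    have hu : ∀ s, overlapRatio M 𝓑 e hist (s, e s) =
        (learnerPolicy 𝓑 hist s {e s}) ^ (1 / 2 : ℝ) * (overlap M 𝓑 e hist)⁻¹ :=
      fun s => div_eq_mul_inv _ _
    rw [lintegral_congr hu, lintegral_mul_const _ hq, ← div_eq_mul_inv]
    exact ENNReal.div_self_le_one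

/-- The high-probability event of the guarantee. -/
def goodEvent (e : S → A) (N : ℕ) (δ : ℝ) : Set (Fin N → S × A) :=
  {run | Annotated e run} ∩ {run | overlapProduct M 𝓑 e run < ENNReal.ofReal (1 / δ)}

theorem measurableSet_goodEvent (hem : Measurable e) (N : ℕ) (δ : ℝ) :
    MeasurableSet (goodEvent M 𝓑 e N δ) :=
  (measurableSet_annotated hem N).inter
    (measurableSet_lt (measurable_overlapProduct M 𝓑 hem N) measurable_const)

variable {𝓑}

/-- Markov's inequality for the supermartingale at level 1/δ, combined with the almost sure
correctness of the labels. -/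
theorem staggerLaw_goodEvent (hH : 0 < M.horizon) (hmem : πE ∈ 𝓑)
    (he : ∀ s, πE.1 s = Measure.dirac (e s)) (N : ℕ) {δ : ℝ} (hδ : 0 < δ) :
    ENNReal.ofReal (1 - δ) ≤ staggerLaw M 𝓑 πE N (goodEvent M 𝓑 e N δ) := by
  have hem := measurable_annotator he
  have hbad : staggerLaw M 𝓑 πE N {run | ENNReal.ofReal (1 / δ) ≤ overlapProduct M 𝓑 e run} ≤
      ENNReal.ofReal δ := by
    have h := mul_meas_ge_le_lintegral (μ := staggerLaw M 𝓑 πE N)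
      (measurable_overlapProduct M 𝓑 hem N) (ENNReal.ofReal (1 / δ))
    have h' := h.trans (lintegral_overlapProduct_le M 𝓑 he N)
    rw [one_div, ENNReal.ofReal_inv_of_pos hδ] at h' ⊢
    have hδ0 : ENNReal.ofReal δ ≠ 0 := by simpa using hδ
    rwa [mul_comm, ← div_eq_mul_inv, ENNReal.div_le_iff hδ0 ENNReal.ofReal_ne_top, one_mul] at h'
  have hsub : {run | Annotated e run} ⊆ goodEvent M 𝓑 e N δ ∪
      {run | ENNReal.ofReal (1 / δ) ≤ overlapProduct M 𝓑 e run} := fun run hrun =>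
    (lt_or_ge (overlapProduct M 𝓑 e run) (ENNReal.ofReal (1 / δ))).imp (fun h => ⟨hrun, h⟩) id
  have h1 := (measure_mono hsub).trans (measure_union_le (μ := staggerLaw M 𝓑 πE N) _ _)
  rw [staggerLaw_annotated M hH hmem he N] at h1
  rw [ENNReal.ofReal_sub _ hδ.le, ENNReal.ofReal_one, tsub_le_iff_right]
  exact h1.trans (by gcongr)

end RunLaw

/-! ### From returns to step values -/

namespace EpisodicMDP

/-- The reward of a step, as an extended nonnegative real. -/
noncomputable def stepReward {S A : Type*} (x : Step S A) : ℝ≥0∞ := ENNReal.ofReal (x.2.2 : ℝ)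

theorem stepReward_le_one {S A : Type*} (x : Step S A) : stepReward x ≤ 1 :=
  ENNReal.ofReal_le_one.2 x.2.2.2.2

theorem totalReward_nonneg {S A : Type*} {k : ℕ} (τ : Fin k → Step S A) : 0 ≤ totalReward τ :=
  Finset.sum_nonneg fun j _ => (τ j).2.2.2.1

variable {S A : Type*} [MeasurableSpace S] [MeasurableSpace A] (M : EpisodicMDP S A)

theorem measurable_stepReward : Measurable (stepReward : Step S A → ℝ≥0∞) := by
  unfold stepReward
  fun_prop

theorem measurable_totalReward (k : ℕ) :
    Measurable (totalReward : (Fin k → Step S A) → ℝ) := by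
  unfold totalReward
  fun_prop

theorem integral_totalReward {k : ℕ} (ν : Measure (Fin k → Step S A)) :
    ∫ τ, totalReward τ ∂ν = (∫⁻ τ, ∑ j, stepReward (τ j) ∂ν).toReal := by
  rw [integral_eq_lintegral_of_nonneg_ae
    (ae_of_all _ fun τ => totalReward_nonneg τ)
    (measurable_totalReward k).aestronglyMeasurable]
  congr 1
  refine lintegral_congr fun τ => ?_
  exact ENNReal.ofReal_sum_of_nonneg fun j _ => (τ j).2.2.2.1

theorem integrable_totalReward {k : ℕ} (ν : Measure (Fin k → Step S A)) [IsFiniteMeasure ν] :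
    Integrable totalReward ν := by
  refine Integrable.of_bound (measurable_totalReward k).aestronglyMeasurable k
    (ae_of_all _ fun τ => ?_)
  rw [Real.norm_of_nonneg (totalReward_nonneg τ)]
  simpa [totalReward] using Finset.sum_le_card_nsmul Finset.univ (fun j => ((τ j).2.2 : ℝ)) 1
    fun j _ => (τ j).2.2.2.2

theorem J_eq (π : Kernel S A) :
    M.J π = (∫⁻ s, M.stepValue π stepReward M.horizon 0 s ∂M.init).toReal := by
  rw [J, expectedReturn, integral_totalReward, M.lintegral_trajLaw_sum π measurable_stepReward]

theorem expectedReturn_firstStepMixtureLaw {N : ℕ} (π : Fin N → Kernel S A)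
    [∀ n, IsMarkovKernel (π n)] :
    M.expectedReturn (M.firstStepMixtureLaw π) = (N : ℝ)⁻¹ * ∑ n, M.J (π n) := by
  rw [expectedReturn, firstStepMixtureLaw, integral_smul_measure,
    integral_finsetSum_measure fun n _ => integrable_totalReward _]
  simp [J, expectedReturn]

theorem stepValue_ne_top (π : Kernel S A) [IsMarkovKernel π] (k h : ℕ) (s : S) :
    M.stepValue π stepReward k h s ≠ ∞ := by
  refine ((M.stepValue_le π stepReward_le_one k h s).trans_lt ?_).ne
  simp

theorem stepActionValue_ne_top (π : Kernel S A) [IsMarkovKernel π] (k h : ℕ) (x : S × A) :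
    M.stepActionValue π stepReward k h x ≠ ∞ := by
  refine ((M.stepActionValue_le π stepReward_le_one k h x).trans_lt ?_).ne
  simp [ENNReal.add_lt_top]

theorem lintegral_stepValue_ne_top (π : Kernel S A) [IsMarkovKernel π] (k h : ℕ) :
    ∫⁻ s, M.stepValue π stepReward k h s ∂M.init ≠ ∞ := by
  refine ((lintegral_mono fun s => M.stepValue_le π stepReward_le_one k h s).trans_lt ?_).ne
  simp

theorem V_eq (π : Kernel S A) {k h : ℕ} (hk : k + 1 + h = M.horizon) (s : S) :
    M.V π ⟨h, by omega⟩ s = (M.stepValue π stepReward (k + 1) h s).toReal := by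
  have h1 : M.horizon - h = k + 1 := by omega
  rw [V, integral_totalReward, ← h1]
  rfl

theorem Q_eq (π : Kernel S A) {k h : ℕ} (hk : k + 1 + h = M.horizon) (s : S) (a : A) :
    M.Q π ⟨h, by omega⟩ s a = (M.stepActionValue π stepReward k h (s, a)).toReal := by
  have h1 : M.horizon - h - 1 = k := by omega
  subst h1
  rw [Q, integral_totalReward]
  rfl

/-! ### Comparison with a deterministic expert. -/

section Deterministic

variable {πE π : Kernel S A} {e : S → A}

theorem stepValue_eq_stepActionValue [IsSFiniteKernel πE] (he : ∀ s, πE s = Measure.dirac (e s))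
    (k h : ℕ) (s : S) : M.stepValue πE stepReward (k + 1) h s =
      M.stepActionValue πE stepReward k h (s, e s) := by
  rw [M.stepValue_succ πE measurable_stepReward, he]
  exact lintegral_dirac' _
    ((M.measurable_stepActionValue πE measurable_stepReward k h).comp measurable_prodMk_left)

/-- Cost `μ` for each action that differs from the annotator's. -/
noncomputable def mistakeCost (e : S → A) (μ : ℝ) : S × A → ℝ≥0∞ :=
  {x : S × A | x.2 ≠ e x.1}.indicator fun _ => ENNReal.ofReal μ

theorem measurable_mistakeCost [MeasurableEq A] (hem : Measurable e) (μ : ℝ) :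
    Measurable (mistakeCost e μ) :=
  measurable_const.indicator (measurableSet_eq_fun (by fun_prop) (by fun_prop)).compl

theorem lintegral_mistakeCost [MeasurableSingletonClass A] (μ : ℝ) (s : S) :
    ∫⁻ a, mistakeCost e μ (s, a) ∂π s = ENNReal.ofReal μ * π s {e s}ᶜ := by
  rw [← lintegral_indicator_const (measurableSet_singleton (e s)).compl]
  rfl

/-- One round's probability of deviating from the annotator is at most the Hellinger error. -/
theorem lintegral_compl_add_le [MeasurableEq A] [IsMarkovKernel π] (hem : Measurable e)
    (ν : Measure S) [IsProbabilityMeasure ν] :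
    ∫⁻ s, π s {e s}ᶜ ∂ν + 2 * ∫⁻ s, (π s {e s}) ^ (1 / 2 : ℝ) ∂ν ≤ 2 := by
  have hp : Measurable fun s => π s {e s} :=
    (measurable_kernel_singleton π).comp (f := fun s => (s, e s)) (by fun_prop)
  rw [← lintegral_const_mul _ (hp.pow_const _),
    ← lintegral_add_right _ ((hp.pow_const _).const_mul 2)]
  calc _ ≤ ∫⁻ _, 2 ∂ν := ?_
    _ = 2 := by simp
  refine lintegral_mono fun s => ?_
  set x := √(π s {e s}).toReal with hx
  have hx0 : 0 ≤ x := Real.sqrt_nonneg _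
  have h1 : (π s {e s}) ^ (1 / 2 : ℝ) = ENNReal.ofReal x := by
    rw [hx, Real.sqrt_eq_rpow, ← ENNReal.ofReal_rpow_of_nonneg ENNReal.toReal_nonneg (by norm_num),
      ENNReal.ofReal_toReal (measure_ne_top _ _)]
  have h2 : π s {e s}ᶜ = ENNReal.ofReal (1 - x ^ 2) := by
    rw [prob_compl_eq_one_sub (measurableSet_singleton _), hx,
      Real.sq_sqrt ENNReal.toReal_nonneg, ENNReal.ofReal_sub _ ENNReal.toReal_nonneg,
      ENNReal.ofReal_one, ENNReal.ofReal_toReal (measure_ne_top _ _)]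
  have hx1 : x ≤ 1 := by
    refine Real.sqrt_le_iff.2 ⟨zero_le_one, ?_⟩
    exact ENNReal.toReal_le_of_le_ofReal (by norm_num) (by simpa using prob_le_one)
  rw [h1, h2, ← ENNReal.ofReal_ofNat 2, ← ENNReal.ofReal_mul (by norm_num),
    ← ENNReal.ofReal_add (by nlinarith) (by positivity)]
  -- 1 - x² ≤ 2 - 2x is (1 - x)² ≥ 0, with x the square root of the expert action's probability.
  exact ENNReal.ofReal_le_ofReal (by nlinarith [sq_nonneg (1 - x)])

/-- The accumulated cost depends on states only, so its sum over the steps is `horizon` times a mean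
under the visitation distribution. -/
theorem lintegral_stepValue_mistakes [MeasurableEq A] (hem : Measurable e) [IsFiniteKernel π]
    (hH : 0 < M.horizon) (μ : ℝ) :
    ∫⁻ s, M.stepValue π (fun x => ∫⁻ a, mistakeCost e μ (x.1, a) ∂π x.1) M.horizon 0 s ∂M.init =
      M.horizon * (ENNReal.ofReal μ * ∫⁻ s, π s {e s}ᶜ ∂(M.stateVisitation π)) := by
  have hC : Measurable fun s => ∫⁻ a, mistakeCost e μ (s, a) ∂π s :=
    Measurable.lintegral_kernel_prod_right' (measurable_mistakeCost hem μ)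
  rw [← M.lintegral_trajLaw_sum π (f := fun x => ∫⁻ a, mistakeCost e μ (x.1, a) ∂π x.1)
    (hC.comp measurable_fst), ← lintegral_const_mul' _ _ ENNReal.ofReal_ne_top]
  simp_rw [← lintegral_mistakeCost]
  rw [M.lintegral_stateVisitation π hC, ← mul_assoc, ENNReal.mul_inv_cancel (by simpa using hH.ne')
    (by simp), one_mul]

theorem toReal_mistakes_le [MeasurableEq A] (hem : Measurable e) [IsMarkovKernel π]
    (hH : 0 < M.horizon) {μ : ℝ} (hμ : 0 ≤ μ) :
    M.horizon * (ENNReal.ofReal μ * ∫⁻ s, π s {e s}ᶜ ∂(M.stateVisitation π)) ≤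
      ENNReal.ofReal (μ * M.horizon * (2 - 2 *
        (∫⁻ s, (π s {e s}) ^ (1 / 2 : ℝ) ∂(M.stateVisitation π)).toReal)) := by
  have := M.isProbabilityMeasure_stateVisitation π hH
  have h := lintegral_compl_add_le (π := π) hem (M.stateVisitation π)
  set m := ∫⁻ s, π s {e s}ᶜ ∂(M.stateVisitation π)
  set o := ∫⁻ s, (π s {e s}) ^ (1 / 2 : ℝ) ∂(M.stateVisitation π)
  have hm : m ≠ ∞ := ne_top_of_le_ne_top (by simp) ((le_self_add).trans h)
  have ho : 2 * o ≠ ∞ := ne_top_of_le_ne_top (by simp) ((le_add_self).trans h)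
  have hr := ENNReal.toReal_mono (by simp) h
  rw [ENNReal.toReal_add hm ho, ENNReal.toReal_mul] at hr
  simp only [ENNReal.toReal_ofNat] at hr
  rw [← ENNReal.ofReal_toReal hm, ← ENNReal.ofReal_mul hμ, ← ENNReal.ofReal_natCast,
    ← ENNReal.ofReal_mul (by positivity)]
  refine ENNReal.ofReal_le_ofReal ?_
  calc _ = μ * M.horizon * m.toReal := by ring
    _ ≤ _ := by
      gcongr
      linarith

theorem toReal_sub_le_of_le_add {x y : ℝ≥0∞} {r : ℝ} (hy : y ≠ ∞) (hr : 0 ≤ r)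
    (h : x ≤ y + ENNReal.ofReal r) : x.toReal - y.toReal ≤ r := by
  have := ENNReal.toReal_mono (by simp [hy]) h
  rw [ENNReal.toReal_add hy ENNReal.ofReal_ne_top, ENNReal.toReal_ofReal hr] at this
  linarith

theorem le_add_of_toReal_sub_le {x y : ℝ≥0∞} {r : ℝ} (hx : x ≠ ∞) (hy : y ≠ ∞)
    (h : x.toReal - y.toReal ≤ r) : x ≤ y + ENNReal.ofReal r :=
  calc x = ENNReal.ofReal x.toReal := (ENNReal.ofReal_toReal hx).symm
    _ ≤ ENNReal.ofReal (y.toReal + r) := ENNReal.ofReal_le_ofReal (by linarith)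
    _ ≤ ENNReal.ofReal y.toReal + ENNReal.ofReal r := ENNReal.ofReal_add_le
    _ = y + ENNReal.ofReal r := by rw [ENNReal.ofReal_toReal hy]

theorem hellinger_term_nonneg [MeasurableEq A] (hem : Measurable e) [IsMarkovKernel π]
    (ν : Measure S) [IsProbabilityMeasure ν] :
    0 ≤ 2 - 2 * (∫⁻ s, (π s {e s}) ^ (1 / 2 : ℝ) ∂ν).toReal := by
  have h := (le_add_self).trans (lintegral_compl_add_le (π := π) hem ν)
  have hr := ENNReal.toReal_mono (by simp) h
  rw [ENNReal.toReal_mul] at hr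
  simp only [ENNReal.toReal_ofNat] at hr
  linarith

/-- Evaluating either advantage condition at the expert's action therefore forces μ ≥ 0. -/
theorem V_eq_Q [IsSFiniteKernel πE] (he : ∀ s, πE s = Measure.dirac (e s))
    (h : Fin M.horizon) (s : S) : M.V πE h s = M.Q πE h s (e s) := by
  obtain ⟨k, hk⟩ : ∃ k, k + 1 + h = M.horizon := ⟨M.horizon - h - 1, by omega⟩
  exact (M.V_eq πE hk s).trans
    ((congrArg _ (M.stepValue_eq_stepActionValue he k h s)).trans (M.Q_eq πE hk s (e s)).symm)

/-- Agreeing with the expert costs nothing and any other action costs at most μ, so `mistakeCost`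
bounds the one-step deviations and the performance difference inequality applies. -/
theorem J_sub_le_of_recoverable [MeasurableEq A] [IsMarkovKernel πE] [IsMarkovKernel π]
    (hH : 0 < M.horizon) (he : ∀ s, πE s = Measure.dirac (e s)) {μ : ℝ} (hμ : 0 ≤ μ)
    (hrec : M.IsRecoverable πE μ) :
    M.J πE - M.J π ≤ μ * M.horizon * (2 - 2 *
        (∫⁻ s, (π s {e s}) ^ (1 / 2 : ℝ) ∂(M.stateVisitation π)).toReal) := by
  have hem := measurable_annotator he
  have := M.isProbabilityMeasure_stateVisitation π hH
  have hdev : ∀ k h, k + 1 + h = M.horizon → ∀ s a, M.stepValue πE stepReward (k + 1) h s ≤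
      M.stepActionValue πE stepReward k h (s, a) + mistakeCost e μ (s, a) := by
    intro k h hk s a
    by_cases ha : a = e s
    · rw [M.stepValue_eq_stepActionValue he, ha]
      exact le_self_add
    · rw [mistakeCost, Set.indicator_of_mem (by simpa using ha)]
      refine le_add_of_toReal_sub_le (M.stepValue_ne_top _ _ _ _)
        (M.stepActionValue_ne_top _ _ _ _) ?_
      rw [← M.V_eq πE hk, ← M.Q_eq πE hk]
      exact hrec _ s a
  rw [J_eq, J_eq]
  refine toReal_sub_le_of_le_add (M.lintegral_stepValue_ne_top π _ _)
    (mul_nonneg (by positivity) (hellinger_term_nonneg hem _)) ?_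
  refine (lintegral_mono fun s => M.stepValue_le_add_stepValue (π' := π) measurable_stepReward
    (measurable_mistakeCost hem μ) hdev M.horizon 0 (by simp) s).trans ?_
  rw [lintegral_add_left (M.measurable_stepValue π measurable_stepReward _ _),
    M.lintegral_stepValue_mistakes hem hH]
  gcongr
  exact M.toReal_mistakes_le hem hH hμ

theorem J_sub_le_of_advantage_le [MeasurableEq A] [IsMarkovKernel πE] [IsMarkovKernel π]
    (hH : 0 < M.horizon) (he : ∀ s, πE s = Measure.dirac (e s)) {μ : ℝ} (hμ : 0 ≤ μ)
    (hadv : ∀ (h : Fin M.horizon) (s : S) (a : A), M.Q πE h s a - M.V πE h s ≤ μ) :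
    M.J π - M.J πE ≤ μ * M.horizon * (2 - 2 *
        (∫⁻ s, (π s {e s}) ^ (1 / 2 : ℝ) ∂(M.stateVisitation π)).toReal) := by
  have hem := measurable_annotator he
  have := M.isProbabilityMeasure_stateVisitation π hH
  have hdev : ∀ k h, k + 1 + h = M.horizon → ∀ s a,
      M.stepActionValue πE stepReward k h (s, a) ≤
      M.stepValue πE stepReward (k + 1) h s + mistakeCost e μ (s, a) := by
    intro k h hk s a
    by_cases ha : a = e s
    · rw [M.stepValue_eq_stepActionValue he, ha]
      exact le_self_add
    · rw [mistakeCost, Set.indicator_of_mem (by simpa using ha)]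
      refine le_add_of_toReal_sub_le (M.stepActionValue_ne_top _ _ _ _)
        (M.stepValue_ne_top _ _ _ _) ?_
      rw [← M.V_eq πE hk, ← M.Q_eq πE hk]
      exact hadv _ s a
  rw [J_eq, J_eq]
  refine toReal_sub_le_of_le_add (M.lintegral_stepValue_ne_top πE _ _)
    (mul_nonneg (by positivity) (hellinger_term_nonneg hem _)) ?_
  refine (lintegral_mono fun s => M.stepValue_le_stepValue_add (π' := π) measurable_stepReward
    (measurable_mistakeCost hem μ) hdev M.horizon 0 (by simp) s).trans ?_
  rw [lintegral_add_left (M.measurable_stepValue πE measurable_stepReward _ _),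
    M.lintegral_stepValue_mistakes hem hH]
  gcongr
  exact M.toReal_mistakes_le hem hH hμ

theorem integral_hellingerSq [MeasurableEq A] [IsMarkovKernel π] (hem : Measurable e)
    (he : ∀ s, πE s = Measure.dirac (e s)) (ν : Measure S) [IsProbabilityMeasure ν] :
    ∫ s, hellingerSq (π s) (πE s) ∂ν =
      2 - 2 * (∫⁻ s, (π s {e s}) ^ (1 / 2 : ℝ) ∂ν).toReal := by
  have hp : Measurable fun s => (π s {e s}) ^ (1 / 2 : ℝ) :=
    ((measurable_kernel_singleton π).comp (f := fun s => (s, e s)) (by fun_prop)).pow_const _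
  have hle : ∀ s, (π s {e s}) ^ (1 / 2 : ℝ) ≤ 1 := fun s =>
    ENNReal.rpow_le_one prob_le_one (by norm_num)
  have hsq : ∀ s, hellingerSq (π s) (πE s) = 2 - 2 * ((π s {e s}) ^ (1 / 2 : ℝ)).toReal := by
    intro s
    rw [he, hellingerSq_dirac, Real.sqrt_eq_rpow, ENNReal.toReal_rpow]
  have hint : Integrable (fun s => ((π s {e s}) ^ (1 / 2 : ℝ)).toReal) ν :=
    integrable_toReal_of_lintegral_ne_top hp.aemeasurable
      (((lintegral_mono hle).trans_lt (by simp)).ne)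
  simp_rw [hsq]
  rw [integral_sub (integrable_const _) (hint.const_mul 2), integral_const_mul,
    integral_toReal hp.aemeasurable (ae_of_all _ fun s => (hle s).trans_lt ENNReal.one_lt_top)]
  simp

end Deterministic

end EpisodicMDP

/-! ### The guarantee -/

section Guarantee

variable {S A : Type*} [MeasurableSpace S] [MeasurableSpace A] (M : EpisodicMDP S A)
  {𝓑 : Finset (Policy S A)} {πE : Policy S A} {e : S → A} {N : ℕ}
  {run : Fin N → S × A}

theorem isMarkovKernel_roundPolicy (hmem : πE ∈ 𝓑) (he : ∀ s, πE.1 s = Measure.dirac (e s))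
    (h : Annotated e run) (n : Fin N) : IsMarkovKernel (roundPolicy 𝓑 run n) :=
  isMarkovKernel_learnerPolicy 𝓑
    (zero_lt_one.trans_le (one_le_sum_expWeight hmem he (h.castLE n.isLt.le))).ne'

theorem staggerReturn_eq (hmem : πE ∈ 𝓑) (he : ∀ s, πE.1 s = Measure.dirac (e s))
    (h : Annotated e run) :
    staggerReturn M 𝓑 run = (N : ℝ)⁻¹ * ∑ n, M.J (roundPolicy 𝓑 run n) := by
  have := isMarkovKernel_roundPolicy hmem he h
  exact M.expectedReturn_firstStepMixtureLaw _

variable [MeasurableEq A]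

theorem onlineEstError_le (hH : 0 < M.horizon) (hmem : πE ∈ 𝓑)
    (he : ∀ s, πE.1 s = Measure.dirac (e s)) {δ : ℝ} (hδ : 0 < δ)
    (hrun : run ∈ goodEvent M 𝓑 e N δ) :
    onlineEstError M 𝓑 πE run ≤ Real.log 𝓑.card + 2 * Real.log (1 / δ) := by
  obtain ⟨hann, hW⟩ := hrun
  have hem := measurable_annotator he
  set D : Fin N → ℝ := fun n => ∫ s, hellingerSq (roundPolicy 𝓑 run n s) (πE.1 s)
    ∂(M.stateVisitation (roundPolicy 𝓑 run n)) with hD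
  set p : Fin N → ℝ≥0∞ := fun n => roundPolicy 𝓑 run n (run n).1 {(run n).2} with hp
  have hB : (0 : ℝ) < 𝓑.card := by exact_mod_cast Finset.card_pos.2 ⟨πE, hmem⟩
  have hov : ∀ n : Fin N, overlap M 𝓑 e (fun i : Fin n => run (Fin.castLE n.isLt.le i)) ≤
      ENNReal.ofReal (Real.exp (-(D n / 2))) := by
    intro n
    have := isMarkovKernel_roundPolicy hmem he hann n
    have := M.isProbabilityMeasure_stateVisitation (roundPolicy 𝓑 run n) hH
    have hDn := EpisodicMDP.integral_hellingerSq (π := roundPolicy 𝓑 run n) hem he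
      (M.stateVisitation (roundPolicy 𝓑 run n))
    set o := ∫⁻ s, (roundPolicy 𝓑 run n s {e s}) ^ (1 / 2 : ℝ)
      ∂(M.stateVisitation (roundPolicy 𝓑 run n)) with ho
    have ho1 : o ≤ 1 := (lintegral_mono fun s =>
      ENNReal.rpow_le_one prob_le_one (by norm_num)).trans (by simp)
    change o ≤ _
    rw [← ENNReal.ofReal_toReal (ho1.trans_lt ENNReal.one_lt_top).ne]
    refine ENNReal.ofReal_le_ofReal ?_
    -- Here o = 1 - D/2, and 1 + t ≤ exp t at t = -D/2.
    have := Real.add_one_le_exp (-(D n / 2))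
    simp only [hD] at this ⊢
    linarith
  have hfac : ∀ n : Fin N, p n ^ (1 / 2 : ℝ) * ENNReal.ofReal (Real.exp (D n / 2)) ≤
      overlapRatio M 𝓑 e (fun i : Fin n => run (Fin.castLE n.isLt.le i)) (run n) := by
    intro n
    rw [overlapRatio, div_eq_mul_inv, ← neg_neg (D n / 2), Real.exp_neg,
      ENNReal.ofReal_inv_of_pos (Real.exp_pos _)]
    exact mul_le_mul_right (ENNReal.inv_le_inv.2 (hov n)) _
  -- The regret bound ∏ p ≥ 1/B: the likelihoods telescope to the final total weight divided by B.
  have hlik : ENNReal.ofReal (Real.exp (-(Real.log 𝓑.card))) ≤ ∏ n, p n := by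
    rw [Real.exp_neg, Real.exp_log hB, ENNReal.ofReal_inv_of_pos hB, ENNReal.ofReal_natCast,
      ENNReal.inv_le_iff_le_mul (fun _ => by simpa using Finset.ne_empty_of_mem hmem) (by simp),
      mul_comm, prod_roundPolicy_mul_card hmem he hann]
    exact one_le_sum_expWeight hmem he hann
  -- The square roots contribute B^{-1/2} and the inverse overlaps exp(∑ D/2); clearing the halves
  -- after the logarithm gives log B the factor 1 and log(1/δ) the factor 2.
  have hlt : ENNReal.ofReal (Real.exp (-(Real.log 𝓑.card) * (1 / 2) + ∑ n, D n / 2)) <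
      ENNReal.ofReal (1 / δ) := by
    refine lt_of_le_of_lt ?_ hW
    calc _ = ENNReal.ofReal (Real.exp (-(Real.log 𝓑.card))) ^ (1 / 2 : ℝ) *
          ∏ n, ENNReal.ofReal (Real.exp (D n / 2)) := by
          rw [Real.exp_add, ENNReal.ofReal_mul (Real.exp_pos _).le, Real.exp_mul,
            ENNReal.ofReal_rpow_of_pos (Real.exp_pos _), Real.exp_sum,
            ENNReal.ofReal_prod_of_nonneg fun n _ => (Real.exp_pos _).le]
      _ ≤ (∏ n, p n) ^ (1 / 2 : ℝ) * ∏ n, ENNReal.ofReal (Real.exp (D n / 2)) := by gcongr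
      _ = ∏ n, p n ^ (1 / 2 : ℝ) * ENNReal.ofReal (Real.exp (D n / 2)) := by
          rw [Finset.prod_mul_distrib, ENNReal.prod_rpow_of_nonneg (by norm_num)]
      _ ≤ overlapProduct M 𝓑 e run := Finset.prod_le_prod' fun n _ => hfac n
  have hreal := (ENNReal.ofReal_lt_ofReal_iff (by positivity)).1 hlt
  rw [← Real.lt_log_iff_exp_lt (by positivity), ← Finset.sum_div] at hreal
  change ∑ n, D n ≤ _
  linarith

theorem onlineEstError_eq (hH : 0 < M.horizon) (hmem : πE ∈ 𝓑)
    (he : ∀ s, πE.1 s = Measure.dirac (e s)) (h : Annotated e run) :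
    onlineEstError M 𝓑 πE run = ∑ n, (2 - 2 * (∫⁻ s, (roundPolicy 𝓑 run n s {e s}) ^ (1 / 2 : ℝ)
      ∂(M.stateVisitation (roundPolicy 𝓑 run n))).toReal) := by
  refine Finset.sum_congr rfl fun n _ => ?_
  have := isMarkovKernel_roundPolicy hmem he h n
  have := M.isProbabilityMeasure_stateVisitation (roundPolicy 𝓑 run n) hH
  exact EpisodicMDP.integral_hellingerSq (measurable_annotator he) he _

end Guarantee

theorem mainTheorem1 {S A : Type*} [MeasurableSpace S] [MeasurableSpace A] [MeasurableEq A]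
    (M : EpisodicMDP S A) (hH : 0 < M.horizon)
    (𝓑 : Finset (Policy S A)) (πE : Policy S A)
    (hdet : πE.IsDeterministic) (hmem : πE ∈ 𝓑)
    (N : ℕ) (hN : 0 < N) (δ : ℝ) (hδ₀ : 0 < δ) (hδ₁ : δ < 1) :
    ∃ E : Set (Fin N → S × A), MeasurableSet E ∧
      ENNReal.ofReal (1 - δ) ≤ staggerLaw M 𝓑 πE N E ∧
      ∀ run ∈ E,
        onlineEstError M 𝓑 πE run ≤ Real.log 𝓑.card + 2 * Real.log (1 / δ) ∧
        (∀ μ : ℝ, M.IsRecoverable πE.1 μ →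
          M.J πE.1 - staggerReturn M 𝓑 run ≤
            μ * M.horizon * ((Real.log 𝓑.card + 2 * Real.log (1 / δ)) / N)) ∧
        (∀ μ : ℝ,
          (∀ (h : Fin M.horizon) (s : S) (a : A), M.Q πE.1 h s a - M.V πE.1 h s ≤ μ) →
          staggerReturn M 𝓑 run - M.J πE.1 ≤
            μ * M.horizon * ((Real.log 𝓑.card + 2 * Real.log (1 / δ)) / N)) := by
  obtain ⟨e, he⟩ := hdet
  have := πE.2
  -- A state at which to test the hypothesis on μ; its sign is needed to multiply the error bound by
  -- μ.
  obtain ⟨s₀⟩ : Nonempty S := nonempty_of_isProbabilityMeasure M.init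
  have hVQ := M.V_eq_Q he ⟨0, hH⟩ s₀
  have hN' : (N : ℝ) ≠ 0 := by exact_mod_cast hN.ne'
  refine ⟨goodEvent M 𝓑 e N δ, measurableSet_goodEvent M 𝓑 (measurable_annotator he) N δ,
    staggerLaw_goodEvent M hH hmem he N hδ₀, fun run hrun => ?_⟩
  have herr := onlineEstError_le M hH hmem he hδ₀ hrun
  have hmarkov := isMarkovKernel_roundPolicy hmem he hrun.1
  refine ⟨herr, fun μ hμ => ?_, fun μ hμ => ?_⟩
  · have hμ0 : 0 ≤ μ := by simpa [hVQ] using hμ ⟨0, hH⟩ s₀ (e s₀)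
    calc M.J πE.1 - staggerReturn M 𝓑 run
        = (N : ℝ)⁻¹ * ∑ n, (M.J πE.1 - M.J (roundPolicy 𝓑 run n)) := by
          rw [staggerReturn_eq M hmem he hrun.1, Finset.sum_sub_distrib, mul_sub]
          simp [hN']
      _ ≤ (N : ℝ)⁻¹ * (μ * M.horizon * onlineEstError M 𝓑 πE run) := by
          rw [onlineEstError_eq M hH hmem he hrun.1, Finset.mul_sum _ _ (μ * M.horizon)]
          gcongr with n
          exact M.J_sub_le_of_recoverable hH he hμ0 hμ
      _ ≤ (N : ℝ)⁻¹ * (μ * M.horizon * (Real.log 𝓑.card + 2 * Real.log (1 / δ))) := by gcongr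
      _ = _ := by ring
  · have hμ0 : 0 ≤ μ := by simpa [hVQ] using hμ ⟨0, hH⟩ s₀ (e s₀)
    calc staggerReturn M 𝓑 run - M.J πE.1
        = (N : ℝ)⁻¹ * ∑ n, (M.J (roundPolicy 𝓑 run n) - M.J πE.1) := by
          rw [staggerReturn_eq M hmem he hrun.1, Finset.sum_sub_distrib, mul_sub]
          simp [hN']
      _ ≤ (N : ℝ)⁻¹ * (μ * M.horizon * onlineEstError M 𝓑 πE run) := by
          rw [onlineEstError_eq M hH hmem he hrun.1, Finset.mul_sum _ _ (μ * M.horizon)]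
          gcongr with n
          exact M.J_sub_le_of_advantage_le hH he hμ0 hμ
      _ ≤ (N : ℝ)⁻¹ * (μ * M.horizon * (Real.log 𝓑.card + 2 * Real.log (1 / δ))) := by gcongr
      _ = _ := by ring
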